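/- Let $M$ be a compact, oriented smooth manifold with (possibly empty) boundary, of dimension $n\ge 1$, with a Riemannian metric $g$, let $j:\partial M\to M$ be the inclusion, let $v$ be a smooth vector field on $M$ and let $k\ge 0$. On differential forms put $$T_v=\mathrm{id}+v^\flat\wedge\iota_v\quad(\iota_v=0\text{ on functions}),\qquad \star_v=\star T_v,$$ where $\star$ is the Hodge star of $g$, so that $\star_v$ is invertible; put $\delta_v=(-1)^k\star_v^{-1}d\,\star_v$ on $k$-forms ($\delta_v=0$ on functions), and $\Delta_v=d\delta_v+\delta_v d$. Then the boundary value problem for $k$-forms $$\Delta_v\omega=\eta\ \text{ on } M,\qquad j^*\omega=0\ \text{ and }\ j^*(\delta_v\omega)=0\ \text{ on }\partial M$$ (the last condition being void for $k=0$) is elliptic in the sense of the Lopatinskiĭ–Šapiro condition, that is: (i) for every $x\in M$ and every $0\ne\xi\in T_x^*M$ the principal symbol $\sigma_{\Delta_v}(x,\xi):\wedge^kT_x^*M\to\wedge^kT_x^*M$ is an isomorphism; (ii) let $x\in\partial M$, let $\nu\in T^*_xM$ be an inward conormal (i.e. $\nu$ vanishes on $T_x\partial M$ and is positive on inward pointing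 vectors), and let $\xi\in T_x^*M$ have nonzero restriction to $T_x\partial M$. Let $\sigma_1(x,\cdot)$ and $\sigma_2(x,\cdot)$ be the principal symbols of the boundary operators $\omega\mapsto j^*\omega$ (order $0$) and $\omega\mapsto j^*(\delta_v\omega)$ (order $1$), and write $D_t=-i\,\frac{d}{dt}$. Then for all $h_1\in\wedge^{k}T_x^*\partial M\otimes\mathbb C$ and $h_2\in\wedge^{k-1}T_x^*\partial M\otimes\mathbb C$ there is exactly one solution $u:[0,\infty)\to\wedge^kT_x^*M\otimes\mathbb C$ of the ordinary differential equation $$\sigma_{\Delta_v}(x,\xi+\nu D_t)\,u=0$$ that is bounded on $[0,\infty)$ and satisfies $$\big(\sigma_1(x,\xi+\nu D_t)u\big)(0)=h_1,\qquad \big(\sigma_2(x,\xi+\nu D_t)u\big)(0)=h_2$$ (for $k=0$ only the first boundary condition is imposed). Here the principal symbol of an operator $P$ of order $m$ is normalized by $P(f^m\omega)(x)=m!\,\sigma_P(x,df_x)\,\omega_x$ for smooth forms $\omega$ and smooth functions $f$ with $f(x)=0$. -/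

import Mathlib

open Bundle Set Filter Module
open scoped Manifold ContDiff Topology Nat

noncomputable section

namespace VHodge

/-! ### Exterior algebra of an oriented inner product space -/

section PointwiseAlgebra

theorem append_update {V : Type*} {k l : ℕ} (e : Fin k → V) (w : Fin l → V) (i : Fin l) (c : V) :
    Fin.append e (Function.update w i c) =
      Function.update (Fin.append e w) (Fin.natAdd k i) c := by
  ext1 j
  refine Fin.addCases (fun j => ?_) (fun j => ?_) j
  · rw [Function.update_of_ne]
    · simp
    · intro hj
      have := congrArg Fin.val hj
      have hlt := j.isLt
      simp at this
      omega
  · by_cases hj : j = i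
    · subst hj; simp
    · rw [Function.update_of_ne]
      · simp [Function.update_of_ne hj]
      · intro hh
        exact hj (Fin.natAdd_injective _ _ hh)

variable {V : Type*} [NormedAddCommGroup V] [InnerProductSpace ℝ V]

/-- The wedge product `α ∧ β` of a covector with a `k`-form:
`(α ∧ β)(w₀, …, w_k) = ∑ i, (-1)^i α(w_i) β(w₀, …, ŵ_i, …, w_k)`. -/
def wedgeCovector {k : ℕ} (α : V →L[ℝ] ℝ) (β : V [⋀^Fin k]→L[ℝ] ℝ) : V [⋀^Fin (k + 1)]→L[ℝ] ℝ :=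
  ContinuousAlternatingMap.alternatizeUncurryFin (α.smulRight β)

/-- The map `T_v = id + v♭ ∧ ι_v` on `k`-forms, where `ι_v = 0` on `0`-forms. -/
def tMap (v : V) : {k : ℕ} → (V [⋀^Fin k]→L[ℝ] ℝ) → (V [⋀^Fin k]→L[ℝ] ℝ)
  | 0, β => β
  | _ + 1, β => β + wedgeCovector (innerSL ℝ v) (β.curryLeft v)

/-- Insert the vectors `e₁, …, e_k` into the first `k` slots of a form `μ` of degree `n = k + l`;
the result is the `l`-form `w ↦ μ(e₁, …, e_k, w₁, …, w_l)`. -/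
def insertFirst {n k l : ℕ} (h : k + l = n) (μ : V [⋀^Fin n]→L[ℝ] ℝ) (e : Fin k → V) :
    V [⋀^Fin l]→L[ℝ] ℝ where
  toFun w := μ (Fin.append e w ∘ Fin.cast h.symm)
  map_update_add' := by
    subst h
    intro inst w i a b
    have := Subsingleton.elim inst (instDecidableEqFin l)
    subst this
    simp only [append_update]
    exact μ.map_update_add _ _ _ _
  map_update_smul' := by
    subst h
    intro inst w i c a
    have := Subsingleton.elim inst (instDecidableEqFin l)
    subst this
    simp only [append_update]
    exact μ.map_update_smul _ _ _ _
  map_eq_zero_of_eq' := by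
    subst h
    intro w i j hij hne
    refine μ.map_eq_zero_of_eq (i := Fin.natAdd k i) (j := Fin.natAdd k j) _ ?_ ?_
    · simpa using hij
    · exact fun hh => hne (Fin.natAdd_injective _ _ hh)
  cont := by
    subst h
    refine μ.cont.comp (continuous_pi fun j => ?_)
    refine Fin.addCases (fun j => ?_) (fun j => ?_) j
    · simpa using continuous_const
    · simpa using continuous_apply j

variable {n : ℕ} [Fact (finrank ℝ V = n)]

/-- The Riemannian volume form of the oriented inner product space `V`, bundled as a continuous
alternating map. -/
def volForm (o : Orientation ℝ V (Fin n)) : V [⋀^Fin n]→L[ℝ] ℝ :=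
  o.volumeForm.mkContinuous 1 fun w => by
    simpa using o.abs_volumeForm_apply_le w

/-- The Hodge star `⋆ : Λ^k → Λ^l`, `k + l = n`. In an orthonormal basis `e`,
`⋆β = ∑_{i₁ < … < i_k} β(e_{i₁}, …, e_{i_k}) μ(e_{i₁}, …, e_{i_k}, ·)` with `μ` the volume form
(here written as `1 / k!` times the sum over all multi-indices). This is the operator with
`α ∧ ⋆β = ⟨α, β⟩ μ`. -/
def hodgeStar [FiniteDimensional ℝ V] (o : Orientation ℝ V (Fin n)) {k l : ℕ} (h : k + l = n)
    (β : V [⋀^Fin k]→L[ℝ] ℝ) : V [⋀^Fin l]→L[ℝ] ℝ :=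
  ((k ! : ℝ)⁻¹) • ∑ J : Fin k → Fin (finrank ℝ V),
    β (stdOrthonormalBasis ℝ V ∘ J) • insertFirst h (volForm o) (stdOrthonormalBasis ℝ V ∘ J)

/-- The `v`-induced Hodge star `⋆_v = ⋆ T_v`. -/
def hodgeStarV [FiniteDimensional ℝ V] (o : Orientation ℝ V (Fin n)) (v : V) {k l : ℕ}
    (h : k + l = n) (β : V [⋀^Fin k]→L[ℝ] ℝ) : V [⋀^Fin l]→L[ℝ] ℝ :=
  hodgeStar o h (tMap v β)

/-- The inverse `⋆_v⁻¹ : Λ^l → Λ^k` of the (bijective) map `⋆_v : Λ^k → Λ^l`. -/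
def hodgeStarVInv [FiniteDimensional ℝ V] (o : Orientation ℝ V (Fin n)) (v : V) {k l : ℕ}
    (h : k + l = n) : (V [⋀^Fin l]→L[ℝ] ℝ) → (V [⋀^Fin k]→L[ℝ] ℝ) :=
  Function.invFun (hodgeStarV o v h)

end PointwiseAlgebra

/-! ### Differential forms on a manifold with boundary -/

section Manifold

variable {n : ℕ} [NeZero n] {M : Type*} [TopologicalSpace M]
  [ChartedSpace (EuclideanHalfSpace n) M]

/-- A (not necessarily smooth) differential `k`-form on `M`. -/
abbrev DForm (n : ℕ) [NeZero n] (M : Type*) [TopologicalSpace M]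
    [ChartedSpace (EuclideanHalfSpace n) M] (k : ℕ) : Type _ :=
  ∀ x : M, TangentSpace (𝓡∂ n) x [⋀^Fin k]→L[ℝ] ℝ

/-- The expression of a form in the chart around `x₀`: its pullback by the inverse chart. -/
def chartRep {k : ℕ} (x₀ : M) (η : DForm n M k) (y : EuclideanSpace ℝ (Fin n)) :
    EuclideanSpace ℝ (Fin n) [⋀^Fin k]→L[ℝ] ℝ :=
  (η ((extChartAt (𝓡∂ n) x₀).symm y)).compContinuousLinearMap
    (mfderivWithin 𝓘(ℝ, EuclideanSpace ℝ (Fin n)) (𝓡∂ n) (extChartAt (𝓡∂ n) x₀).symm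
      (range (𝓡∂ n)) y)

/-- A form is smooth if its expressions in charts are smooth (up to the boundary). -/
def IsSmoothForm {k : ℕ} (η : DForm n M k) : Prop :=
  ∀ x₀ : M, ContDiffOn ℝ ∞ (chartRep x₀ η) (extChartAt (𝓡∂ n) x₀).target

/-- The exterior derivative on `M`, computed in charts. -/
def dExt {k : ℕ} (η : DForm n M k) : DForm n M (k + 1) := fun x =>
  (extDerivWithin (chartRep x η) (range (𝓡∂ n)) (extChartAt (𝓡∂ n) x x)).compContinuousLinearMap
    (mfderiv (𝓡∂ n) 𝓘(ℝ, EuclideanSpace ℝ (Fin n)) (extChartAt (𝓡∂ n) x) x)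

instance tangentSpaceFinite (x : M) : FiniteDimensional ℝ (TangentSpace (𝓡∂ n) x) :=
  inferInstanceAs (FiniteDimensional ℝ (EuclideanSpace ℝ (Fin n)))

instance tangentSpaceFinrank (x : M) : Fact (finrank ℝ (TangentSpace (𝓡∂ n) x) = n) :=
  ⟨(finrank_euclideanSpace_fin : finrank ℝ (EuclideanSpace ℝ (Fin n)) = n)⟩

/-- The differential at `x` of the first coordinate of the chart around `x`. The model is the
half-space `{y | 0 ≤ y 0}`, so for `x ∈ ∂M` this is the differential of a boundary defining
function, which is positive exactly on the inward pointing vectors. -/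
def boundaryConormal (x : M) : TangentSpace (𝓡∂ n) x →L[ℝ] ℝ :=
  (EuclideanSpace.proj (0 : Fin n) : EuclideanSpace ℝ (Fin n) →L[ℝ] ℝ).comp
    (mfderiv (𝓡∂ n) 𝓘(ℝ, EuclideanSpace ℝ (Fin n)) (extChartAt (𝓡∂ n) x) x)

/-- The tangent space `T_x ∂M ⊆ T_x M` of the boundary at `x ∈ ∂M`. -/
def boundaryTangent (x : M) : Submodule ℝ (TangentSpace (𝓡∂ n) x) :=
  LinearMap.ker (boundaryConormal x).toLinearMap

/-- A (not necessarily smooth) differential `l`-form on `∂M`. -/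
abbrev BForm (n : ℕ) [NeZero n] (M : Type*) [TopologicalSpace M]
    [ChartedSpace (EuclideanHalfSpace n) M] (l : ℕ) : Type _ :=
  ∀ x : (𝓡∂ n).boundary M, boundaryTangent (n := n) (x : M) [⋀^Fin l]→L[ℝ] ℝ

/-- The pullback `j^*` by the inclusion `j : ∂M → M`. -/
def pullbackBoundary {k : ℕ} (η : DForm n M k) : BForm n M k := fun x =>
  (η x).compContinuousLinearMap (boundaryTangent (n := n) (x : M)).subtypeL

/-! ### Principal symbols and the Lopatinskiĭ–Šapiro condition -/

/-- `σ` is the principal symbol at `x` of an operator of order `m` acting on `k`-forms, where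
`L η` is the value at (the fibre over) `x` of the operator applied to `η`:
`L (f^m η) = m! σ(df_x) η_x` for all smooth forms `η` and smooth functions `f` with `f x = 0`.
(Factors of `i` are not included.) -/
def IsPrincipalSymbolAt {k : ℕ} {W : Type*} [AddCommGroup W] [Module ℝ W] (m : ℕ) (x : M)
    (L : DForm n M k → W)
    (σ : (TangentSpace (𝓡∂ n) x →L[ℝ] ℝ) → (TangentSpace (𝓡∂ n) x [⋀^Fin k]→L[ℝ] ℝ) →ₗ[ℝ] W) :
    Prop :=
  ∀ (f : M → ℝ) (η : DForm n M k), ContMDiff (𝓡∂ n) 𝓘(ℝ, ℝ) ∞ f → IsSmoothForm η → f x = 0 →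
    L (fun y => f y ^ m • η y) = (m ! : ℝ) • σ (mfderiv (𝓡∂ n) 𝓘(ℝ, ℝ) f x) (η x)

/-- A boundary operator of a given order, mapping `k`-forms on `M` to forms on `∂M`. -/
structure BoundaryOperator (n : ℕ) [NeZero n] (M : Type*) [TopologicalSpace M]
    [ChartedSpace (EuclideanHalfSpace n) M] (k : ℕ) where
  order : ℕ
  degree : ℕ
  op : DForm n M k → BForm n M degree

/-- The complexification of a real linear map between spaces of alternating forms, acting on
complex-valued alternating forms. -/
def complexify {V W : Type*} [AddCommGroup V] [Module ℝ V] [TopologicalSpace V]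
    [AddCommGroup W] [Module ℝ W] [TopologicalSpace W] {k l : ℕ}
    (S : (V [⋀^Fin k]→L[ℝ] ℝ) →ₗ[ℝ] (W [⋀^Fin l]→L[ℝ] ℝ)) (u : V [⋀^Fin k]→L[ℝ] ℂ) :
    W [⋀^Fin l]→L[ℝ] ℂ :=
  Complex.ofRealCLM.compContinuousAlternatingMap
      (S (Complex.reCLM.compContinuousAlternatingMap u)) +
    Complex.I • Complex.ofRealCLM.compContinuousAlternatingMap
      (S (Complex.imCLM.compContinuousAlternatingMap u))

/-- `a₀, …, a_m` are the coefficients of the polynomial `τ ↦ σ(ξ + τ ν)`. -/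
def IsSymbolExpansion {C H : Type*} [AddCommGroup C] [Module ℝ C] [AddCommGroup H] [Module ℝ H]
    (m : ℕ) (σ : C → H) (ξ ν : C) (a : Fin (m + 1) → H) : Prop :=
  ∀ τ : ℝ, σ (ξ + τ • ν) = ∑ j : Fin (m + 1), τ ^ (j : ℕ) • a j

/-- For `σ(ξ + τ ν) = ∑ j, τ^j a_j`, the value at `t` of `σ(ξ + ν D_t) u`, where
`D_t = -i d/dt`, i.e. of `∑ j, (-i)^j a_j u^{(j)}`. -/
def symbolODE {V W : Type*} [NormedAddCommGroup V] [NormedSpace ℝ V]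
    [AddCommGroup W] [Module ℝ W] [TopologicalSpace W] {k l m : ℕ}
    (a : Fin (m + 1) → ((V [⋀^Fin k]→L[ℝ] ℝ) →ₗ[ℝ] (W [⋀^Fin l]→L[ℝ] ℝ)))
    (u : ℝ → V [⋀^Fin k]→L[ℝ] ℂ) (t : ℝ) : W [⋀^Fin l]→L[ℝ] ℂ :=
  ∑ j : Fin (m + 1), (-Complex.I) ^ (j : ℕ) • complexify (a j) (iteratedDeriv (j : ℕ) u t)

variable [RiemannianBundle (fun x : M => TangentSpace (𝓡∂ n) x)]

/-- The boundary value problem `A η = φ` on `M`, `B_i η = 0` on `∂M`, with `A` of order `m`, is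
elliptic in the sense of Lopatinskiĭ–Šapiro:
* `A` is elliptic, i.e. its principal symbol `σ_A(x, ξ)` exists and is bijective for every `x ∈ M`
  and every covector `ξ ≠ 0`;
* at every `x ∈ ∂M`, the `B_i` have principal symbols, and for every inward conormal `ν` and every
  covector `ξ` whose restriction to `T_x ∂M` is nonzero, each choice of boundary data
  `h = (h_i)` admits exactly one solution `u` of the linear ODE `σ_A(x, ξ + ν D_t) u = 0` that is
  bounded on `[0, ∞)` and satisfies `σ_{B_i}(x, ξ + ν D_t) u (0) = h_i` for all `i`.
(The ODE has constant coefficients and invertible leading coefficient, so it makes no difference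
whether it is posed on `[0, ∞)` or on `ℝ`.) -/
def IsLopatinskiiShapiroElliptic {k : ℕ} (m : ℕ) (A : DForm n M k → DForm n M k)
    (B : List (BoundaryOperator n M k)) : Prop :=
  (∀ x : M, ∃ σA, IsPrincipalSymbolAt m x (fun η => A η x) σA ∧
    ∀ ξ : TangentSpace (𝓡∂ n) x →L[ℝ] ℝ, ξ ≠ 0 → Function.Bijective (σA ξ)) ∧
  ∀ x : (𝓡∂ n).boundary M, ∃ σA, IsPrincipalSymbolAt m (x : M) (fun η => A η x) σA ∧
    ∃ σB : ∀ i : Fin B.length, (TangentSpace (𝓡∂ n) (x : M) →L[ℝ] ℝ) →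
        (TangentSpace (𝓡∂ n) (x : M) [⋀^Fin k]→L[ℝ] ℝ) →ₗ[ℝ]
          (boundaryTangent (x : M) [⋀^Fin (B.get i).degree]→L[ℝ] ℝ),
      (∀ i, IsPrincipalSymbolAt (B.get i).order (x : M) (fun η => (B.get i).op η x) (σB i)) ∧
      ∀ ξ ν : TangentSpace (𝓡∂ n) (x : M) →L[ℝ] ℝ,
        (∃ w ∈ boundaryTangent (x : M), ξ w ≠ 0) →
        (∃ c : ℝ, 0 < c ∧ ν = c • boundaryConormal (x : M)) →
        ∃ a, IsSymbolExpansion m σA ξ ν a ∧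
        ∃ b : ∀ i : Fin B.length, Fin ((B.get i).order + 1) → _,
          (∀ i, IsSymbolExpansion (B.get i).order (σB i) ξ ν (b i)) ∧
          ∀ h : ∀ i : Fin B.length, boundaryTangent (x : M) [⋀^Fin (B.get i).degree]→L[ℝ] ℂ,
            ∃! u : ℝ → TangentSpace (𝓡∂ n) (x : M) [⋀^Fin k]→L[ℝ] ℂ,
              ContDiff ℝ ∞ u ∧ (∀ t, symbolODE a u t = 0) ∧
              (∃ C : ℝ, ∀ t, 0 ≤ t → ‖u t‖ ≤ C) ∧
              ∀ i, symbolODE (b i) u 0 = h i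

/-! ### The `v`-induced operators and the boundary value problem -/

/-- A field of orientations of the tangent spaces is an orientation of `M` if, near each point, the
coordinate frame of a chart is positively oriented everywhere or negatively oriented everywhere. -/
def IsManifoldOrientation (o : ∀ x : M, Orientation ℝ (TangentSpace (𝓡∂ n) x) (Fin n)) : Prop :=
  ∀ x₀ : M,
    (∀ᶠ y in 𝓝 x₀, 0 < chartRep x₀ (fun x => volForm (o x)) (extChartAt (𝓡∂ n) x₀ y)
      (fun i => EuclideanSpace.single i 1)) ∨
    (∀ᶠ y in 𝓝 x₀, chartRep x₀ (fun x => volForm (o x)) (extChartAt (𝓡∂ n) x₀ y)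
      (fun i => EuclideanSpace.single i 1) < 0)

variable (o : ∀ x : M, Orientation ℝ (TangentSpace (𝓡∂ n) x) (Fin n))
  (v : ∀ x : M, TangentSpace (𝓡∂ n) x)

/-- The `v`-induced codifferential `δ_v = (-1)^(k+1) ⋆_v⁻¹ d ⋆_v` from `(k+1)`-forms to `k`-forms
(there are no nonzero `(k+1)`-forms if `k + 1 > n`). -/
def codiffV {k : ℕ} (η : DForm n M (k + 1)) : DForm n M k := fun x =>
  if h : k + 1 ≤ n then
    (-1 : ℝ) ^ (k + 1) • hodgeStarVInv (l := n - (k + 1) + 1) (o x) (v x) (by omega)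
      (dExt (fun y => hodgeStarV (l := n - (k + 1)) (o y) (v y) (by omega) (η y)) x)
  else 0

/-- The `v`-induced Hodge Laplacian `Δ_v = d δ_v + δ_v d` on `k`-forms, where `δ_v = 0` on
`0`-forms. -/
def laplacianV : {k : ℕ} → DForm n M k → DForm n M k
  | 0, η => codiffV o v (dExt η)
  | _ + 1, η => dExt (codiffV o v η) + codiffV o v (dExt η)

/-- The boundary conditions `j^* η = 0` (order `0`) and `j^* (δ_v η) = 0` (order `1`); the second
one is void on `0`-forms. -/
def boundaryConditionsV : (k : ℕ) → List (BoundaryOperator n M k)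
  | 0 => [⟨0, 0, pullbackBoundary⟩]
  | k + 1 => [⟨0, k + 1, pullbackBoundary⟩, ⟨1, k, fun η => pullbackBoundary (codiffV o v η)⟩]

end Manifold

end VHodge

end

/-! Write X_ξ = ξ♯ + ξ(v) v. The identities ι_a T_v = T_v ι_{X_a} (`curryLeft_tMap`) and a♭ ∧ ⋆β = ±
⋆ ι_a β (`wedgeCovector_hodgeStar`) give the Leibniz rule δ_v(fη) = -ι_{X_df} η + f δ_v η
(`codiffV_smul`). So δ_v has the symbol of the usual codifferential, with X_ξ in place of ξ♯. By
Cartan's identity for ι and ∧, the symbol of Δ_v is then the scalar -ξ(X_ξ) = -(|ξ|² + ξ(v)²), which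
is nonzero for ξ ≠ 0.

Since the symbol is scalar, the model equation is governed by the real quadratic polynomial τ ↦ (ξ +
τν)(X_{ξ+τν}). The pairing η(X_ξ) is an inner product on covectors and ξ, ν are independent, so
strict Cauchy–Schwarz (`discriminant_pos`) excludes real roots. With τ the root in the upper half
plane, the bounded solutions are exactly exp(iτt) β with β arbitrary
(`exists_root_bounded_solutions`). The boundary conditions prescribe j^*β and j^*(ι_{X_ξ + τ X_ν}
β). As ν(X_ν) > 0 and Im τ > 0, this complex vector is transversal to the complexified boundary
tangent space, so β exists and is unique (`existsUnique_form_restrict_complex`).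

The remaining work shows that the actual operators have these symbols. For a second order operator
the Leibniz rule is applied twice, so d and δ_v must preserve smoothness. For d this rests on
independence of the chart (`chartRep_dExt_of_differentiableWithinAt`), for ⋆_v on a formula in the
Gram matrix of a coordinate frame (`hodgeStar_apply_basis_eq_det`), and for its inverse on
smoothness of operator inversion. -/

noncomputable section

namespace VHodge

/-! ### Interior products, the Hodge star and the map `T_v` on an inner product space -/

section Covector

variable {V F : Type*} [NormedAddCommGroup V] [NormedSpace ℝ V] [NormedAddCommGroup F]
  [NormedSpace ℝ F]

/-- The wedge product of a covector with a vector-valued `k`-form. -/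
def covectorWedge {k : ℕ} (α : V →L[ℝ] ℝ) (β : V [⋀^Fin k]→L[ℝ] F) : V [⋀^Fin (k + 1)]→L[ℝ] F :=
  ContinuousAlternatingMap.alternatizeUncurryFin (α.smulRight β)

theorem covectorWedge_apply {k : ℕ} (α : V →L[ℝ] ℝ) (β : V [⋀^Fin k]→L[ℝ] F)
    (w : Fin (k + 1) → V) :
    covectorWedge α β w = ∑ i : Fin (k + 1), (-1 : ℤ) ^ (i : ℕ) • α (w i) • β (i.removeNth w) := by
  simp [covectorWedge, ContinuousAlternatingMap.alternatizeUncurryFin_apply]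

theorem curryLeft_covectorWedge_zero (α : V →L[ℝ] ℝ) (β : V [⋀^Fin 0]→L[ℝ] F) (a : V) :
    (covectorWedge α β).curryLeft a = α a • β := by
  ext w
  simp only [ContinuousAlternatingMap.curryLeft_apply_apply, covectorWedge_apply,
    ContinuousAlternatingMap.smul_apply]
  simp [Subsingleton.elim (Fin.tail (Matrix.vecCons a w)) w]

/-- The term i = 0 of the expansion pairs α with a; in the others every index is shifted by one,
which flips the sign. -/
theorem curryLeft_covectorWedge_succ {k : ℕ} (α : V →L[ℝ] ℝ) (β : V [⋀^Fin (k + 1)]→L[ℝ] F)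
    (a : V) :
    (covectorWedge α β).curryLeft a = α a • β - covectorWedge α (β.curryLeft a) := by
  ext w
  simp only [ContinuousAlternatingMap.curryLeft_apply_apply, covectorWedge_apply,
    ContinuousAlternatingMap.smul_apply, ContinuousAlternatingMap.sub_apply]
  rw [Fin.sum_univ_succ, sub_eq_add_neg, ← Finset.sum_neg_distrib]
  congr 1
  · simp [Matrix.vecCons]
  · refine Finset.sum_congr rfl fun i _ => ?_
    have h : i.succ.removeNth (Matrix.vecCons a w) = Matrix.vecCons a (i.removeNth w) := by
      ext1 j
      refine Fin.cases ?_ (fun j => ?_) j <;> simp [Fin.removeNth]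
    rw [h]
    simp [pow_succ]

theorem covectorWedge_add_right {k : ℕ} (α : V →L[ℝ] ℝ) (β β' : V [⋀^Fin k]→L[ℝ] F) :
    covectorWedge α (β + β') = covectorWedge α β + covectorWedge α β' := by
  ext w
  simp [covectorWedge_apply, Finset.sum_add_distrib]

theorem covectorWedge_smul_right {k : ℕ} (c : ℝ) (α : V →L[ℝ] ℝ) (β : V [⋀^Fin k]→L[ℝ] F) :
    covectorWedge α (c • β) = c • covectorWedge α β := by
  ext w
  simp only [covectorWedge_apply, ContinuousAlternatingMap.smul_apply, Finset.smul_sum]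
  refine Finset.sum_congr rfl fun i _ => ?_
  rw [smul_comm c, smul_comm c]

/-- Polarization of ι_a ι_a = 0. -/
theorem curryLeft_curryLeft_swap {k : ℕ} (β : V [⋀^Fin (k + 2)]→L[ℝ] F) (a b : V) :
    (β.curryLeft a).curryLeft b = -(β.curryLeft b).curryLeft a := by
  have h := ContinuousAlternatingMap.curryLeft_same β (a + b)
  simp only [map_add, ContinuousAlternatingMap.curryLeft_add, add_apply,
    ContinuousAlternatingMap.curryLeft_same, zero_add, add_zero] at h
  exact eq_neg_of_add_eq_zero_right h

theorem eq_zero_of_curryLeft_eq_zero {k : ℕ} {β : V [⋀^Fin (k + 1)]→L[ℝ] F}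
    (h : ∀ a, β.curryLeft a = 0) : β = 0 := by
  ext w
  have := congrArg (fun γ => γ (Fin.tail w)) (h (w 0))
  simpa [Matrix.vecCons] using this

theorem form_eq_zero_of_finrank_lt [FiniteDimensional ℝ V] {k : ℕ} (hk : finrank ℝ V < k)
    (β : V [⋀^Fin k]→L[ℝ] F) : β = 0 := by
  ext w
  refine β.toAlternatingMap.map_linearDependent w fun hw => ?_
  have := hw.fintype_card_le_finrank
  simp at this
  omega

instance finiteDimensional_forms [FiniteDimensional ℝ V] [FiniteDimensional ℝ F] (k : ℕ) :
    FiniteDimensional ℝ (V [⋀^Fin k]→L[ℝ] F) := by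
  let f : (V [⋀^Fin k]→L[ℝ] F) →ₗ[ℝ] MultilinearMap ℝ (fun _ : Fin k => V) F :=
    { toFun := fun β => β.toMultilinearMap
      map_add' := fun _ _ => rfl
      map_smul' := fun _ _ => rfl }
  refine FiniteDimensional.of_injective f fun a b h => ?_
  ext w
  exact congrArg (fun γ => γ w) h

end Covector

/-! ### The map `T_v` and its commutation with interior products. -/

section Star

variable {V : Type*} [NormedAddCommGroup V] [InnerProductSpace ℝ V]

theorem wedgeCovector_eq {k : ℕ} (α : V →L[ℝ] ℝ) (β : V [⋀^Fin k]→L[ℝ] ℝ) :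
    wedgeCovector α β = covectorWedge α β := rfl

/-- The vector `X_a = a + ⟨v, a⟩ v`, characterized by `ι_a T_v = T_v ι_{X_a}`. -/
def symbolVector (v : V) : V →ₗ[ℝ] V where
  toFun a := a + inner ℝ v a • v
  map_add' a b := by rw [inner_add_right]; module
  map_smul' c a := by rw [inner_smul_right]; simp; module

theorem symbolVector_apply (v a : V) : symbolVector v a = a + inner ℝ v a • v := rfl

/-- The antiderivation rule gives ι_a(v♭ ∧ ι_v β) = ⟨v, a⟩ ι_v β + v♭ ∧ ι_v ι_a β. On the right, the
summand ⟨v, a⟩ v of X_a contributes only ⟨v, a⟩ ι_v β, since ι_v ι_v = 0. -/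
theorem curryLeft_tMap (v a : V) {k : ℕ} (β : V [⋀^Fin (k + 1)]→L[ℝ] ℝ) :
    (tMap v β).curryLeft a = tMap v (β.curryLeft (symbolVector v a)) := by
  cases k with
  | zero =>
    simp only [tMap, wedgeCovector_eq, ContinuousAlternatingMap.curryLeft_add,
      add_apply, curryLeft_covectorWedge_zero, symbolVector_apply, map_add,
      map_smul, innerSL_apply_apply]
  | succ k =>
    simp only [tMap, wedgeCovector_eq, ContinuousAlternatingMap.curryLeft_add,
      add_apply, curryLeft_covectorWedge_succ, symbolVector_apply, map_add,
      map_smul, innerSL_apply_apply, ContinuousAlternatingMap.curryLeft_smul,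
      smul_apply, ContinuousAlternatingMap.curryLeft_same, smul_zero, add_zero]
    rw [curryLeft_curryLeft_swap β a v, ← neg_one_smul ℝ (ContinuousAlternatingMap.curryLeft _ _),
      covectorWedge_smul_right]
    module

theorem tMap_add (v : V) {k : ℕ} (β γ : V [⋀^Fin k]→L[ℝ] ℝ) :
    tMap v (β + γ) = tMap v β + tMap v γ := by
  cases k with
  | zero => rfl
  | succ k =>
    simp only [tMap, wedgeCovector_eq, ContinuousAlternatingMap.curryLeft_add,
      add_apply, covectorWedge_add_right]
    abel

theorem tMap_smul (v : V) {k : ℕ} (c : ℝ) (β : V [⋀^Fin k]→L[ℝ] ℝ) :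
    tMap v (c • β) = c • tMap v β := by
  cases k with
  | zero => rfl
  | succ k =>
    simp only [tMap, wedgeCovector_eq, ContinuousAlternatingMap.curryLeft_smul,
      smul_apply, covectorWedge_smul_right, smul_add]

/-- Contracting with v and using X_v = (1 + |v|²) v reduces the degree: by induction ι_v β = 0, and
then T_v β = β. -/
theorem eq_zero_of_tMap_eq_zero (v : V) {k : ℕ} {β : V [⋀^Fin k]→L[ℝ] ℝ} (h : tMap v β = 0) :
    β = 0 := by
  induction k with
  | zero => exact h
  | succ k ih =>
    have h1 : β.curryLeft v = 0 := by
      have h2 := ih (β := β.curryLeft (symbolVector v v)) (by rw [← curryLeft_tMap, h]; rfl)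
      have h3 : symbolVector v v = (1 + ‖v‖ ^ 2) • v := by
        rw [symbolVector_apply, real_inner_self_eq_norm_sq]; module
      rw [h3, map_smul] at h2
      exact (smul_eq_zero.1 h2).resolve_left (by positivity)
    have h4 : wedgeCovector (innerSL ℝ v) (0 : V [⋀^Fin k]→L[ℝ] ℝ) = 0 := by
      rw [wedgeCovector_eq]; ext w; simp [covectorWedge_apply]
    simpa only [tMap, h1, h4, add_zero] using h

end Star

/-! ### Removing an entry from a concatenated tuple. -/

theorem removeNth_castAdd_append {V : Type*} {k l : ℕ} (e : Fin (k + 1) → V) (w : Fin (l + 1) → V)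
    (a : Fin (k + 1)) :
    (Fin.castAdd (l + 1) a).removeNth (n := k + 1 + l) (α := fun _ => V)
        (Fin.append (m := k + 1) (n := l + 1) e w) =
      Fin.append (a.removeNth e) w ∘ Fin.cast (by omega : k + 1 + l = k + (l + 1)) := by
  ext1 j
  obtain ⟨j, rfl⟩ : ∃ j', j = Fin.cast (by omega : k + (l + 1) = k + 1 + l) j' :=
    ⟨Fin.cast (by omega) j, by simp⟩
  refine Fin.addCases (fun j => ?_) (fun j => ?_) j
  · have h : (Fin.castAdd (l + 1) a).succAbove (n := k + 1 + l)
        (Fin.cast (by omega) (Fin.castAdd (l + 1) j)) = Fin.castAdd (l + 1) (a.succAbove j) := by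
      ext
      simp only [Fin.succAbove, Fin.lt_def]
      split_ifs with h1 h2 h2 <;> (simp_all; try omega)
    simp only [Fin.removeNth, h, Fin.append_left, Function.comp_apply, Fin.cast_cast, Fin.cast_eq_self]
  · have h : (Fin.castAdd (l + 1) a).succAbove (n := k + 1 + l)
        (Fin.cast (by omega) (Fin.natAdd k j)) = Fin.natAdd (k + 1) j := by
      ext
      have := a.isLt
      simp only [Fin.succAbove, Fin.lt_def]
      split_ifs with h1
      · simp at h1; omega
      · simp; omega
    simp only [Fin.removeNth, h, Fin.append_right, Function.comp_apply, Fin.cast_cast, Fin.cast_eq_self]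

theorem removeNth_natAdd_append {V : Type*} {k l : ℕ} (e : Fin k → V) (w : Fin (l + 1) → V)
    (i : Fin (l + 1)) :
    (Fin.natAdd k i).removeNth (n := k + l) (α := fun _ => V)
        (Fin.append (m := k) (n := l + 1) e w) =
      Fin.append e (i.removeNth w) := by
  ext1 j
  refine Fin.addCases (fun j => ?_) (fun j => ?_) j
  · have h : (Fin.natAdd k i).succAbove (n := k + l) (Fin.castAdd l j) =
        Fin.castAdd (l + 1) j := by
      ext
      have := j.isLt
      simp only [Fin.succAbove, Fin.lt_def]
      split_ifs with h1
      · simp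
      · simp at h1; omega
    simp only [Fin.removeNth, h, Fin.append_left]
  · have h : (Fin.natAdd k i).succAbove (n := k + l) (Fin.natAdd k j) =
        Fin.natAdd k (i.succAbove j) := by
      ext
      simp only [Fin.succAbove, Fin.lt_def]
      split_ifs with h1 h2 h2 <;> simp_all <;> omega
    simp only [Fin.removeNth, h, Fin.append_right]

/-! ### The Hodge star and wedge products with covectors. -/

section Star

variable {V : Type*} [NormedAddCommGroup V] [InnerProductSpace ℝ V] [FiniteDimensional ℝ V]

/-- Expansion of `ξ ∧ μ = 0` for a form `μ` of top degree. -/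
theorem sum_append_removeNth_top {k l : ℕ} (hV : finrank ℝ V = k + 1 + l) (ξ : V →L[ℝ] ℝ)
    (μ : V [⋀^Fin (k + 1 + l)]→L[ℝ] ℝ) (e : Fin (k + 1) → V) (w : Fin (l + 1) → V) :
    ∑ i : Fin (l + 1), (-1 : ℝ) ^ (i : ℕ) * (ξ (w i) * μ (Fin.append e (i.removeNth w))) =
      (-1) ^ k * ∑ a : Fin (k + 1), (-1 : ℝ) ^ (a : ℕ) * (ξ (e a) *
        μ (Fin.append (a.removeNth e) w ∘ Fin.cast (by omega : k + 1 + l = k + (l + 1)))) := by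
  have h0 : covectorWedge ξ μ = 0 := form_eq_zero_of_finrank_lt (by omega) _
  have h := congrArg (fun γ => γ (Fin.append (m := k + 1) (n := l + 1) e w)) h0
  simp only [covectorWedge_apply] at h
  replace h := (Fin.sum_univ_add (fun i : Fin (k + 1 + (l + 1)) => (-1 : ℤ) ^ (i : ℕ) •
    ξ (Fin.append e w i) • μ (Fin.removeNth (n := k + 1 + l) (α := fun _ => V) i
      (Fin.append (m := k + 1) (n := l + 1) e w)))).symm.trans h
  simp only [Fin.append_left, Fin.append_right, ContinuousAlternatingMap.coe_zero,
    Pi.zero_apply] at h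
  have h1 : ∀ i : Fin (k + 1), (Fin.castAdd (l + 1) i).removeNth (n := k + 1 + l)
      (α := fun _ => V) (Fin.append (m := k + 1) (n := l + 1) e w) = _ := removeNth_castAdd_append e w
  have h2 : ∀ i : Fin (l + 1), (Fin.natAdd (k + 1) i).removeNth (n := k + 1 + l)
      (α := fun _ => V) (Fin.append (m := k + 1) (n := l + 1) e w) = _ := removeNth_natAdd_append e w
  simp only [h1, h2] at h
  have h3 : (-1 : ℝ) ^ k * (-1 : ℝ) ^ k = 1 := by rw [← mul_pow]; simp
  have h4 : ∑ x : Fin (l + 1), (-1 : ℤ) ^ (Fin.natAdd (k + 1) x : ℕ) •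
      ξ (w x) • μ (Fin.append e (x.removeNth w)) = (-1 : ℝ) ^ (k + 1) *
      ∑ i : Fin (l + 1), (-1 : ℝ) ^ (i : ℕ) * (ξ (w i) * μ (Fin.append e (i.removeNth w))) := by
    rw [Finset.mul_sum]
    refine Finset.sum_congr rfl fun i _ => ?_
    simp [pow_add, mul_assoc]
  rw [h4] at h
  have h5 : ∀ a : Fin (k + 1), (-1 : ℤ) ^ (Fin.castAdd (l + 1) a : ℕ) • ξ (e a) •
      μ (Fin.append (a.removeNth e) w ∘ Fin.cast (by omega : k + 1 + l = k + (l + 1))) =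
      (-1 : ℝ) ^ (a : ℕ) * (ξ (e a) *
        μ (Fin.append (a.removeNth e) w ∘ Fin.cast (by omega : k + 1 + l = k + (l + 1)))) :=
    fun a => by simp
  simp only [h5] at h
  rw [pow_succ] at h
  -- The entries of `w` sit k + 1 places further right, so their block carries the sign (-1)^(k+1);
  -- multiplying by (-1)^k clears it.
  linear_combination (-(-1) ^ k) * h - (∑ i : Fin (l + 1), (-1 : ℝ) ^ (i : ℕ) *
    (ξ (w i) * μ (Fin.append e (i.removeNth w)))) * h3

variable {n : ℕ} [Fact (finrank ℝ V = n)] (o : Orientation ℝ V (Fin n))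

theorem hodgeStar_apply {k l : ℕ} (h : k + l = n) (β : V [⋀^Fin k]→L[ℝ] ℝ) (w : Fin l → V) :
    hodgeStar o h β w = (k ! : ℝ)⁻¹ * ∑ J : Fin k → Fin (finrank ℝ V),
      β (stdOrthonormalBasis ℝ V ∘ J) *
        volForm o (Fin.append (stdOrthonormalBasis ℝ V ∘ J) w ∘ Fin.cast h.symm) := by
  simp only [hodgeStar, ContinuousAlternatingMap.smul_apply, ContinuousAlternatingMap.sum_apply,
    smul_eq_mul]
  rfl

theorem hodgeStar_add {k l : ℕ} (h : k + l = n) (β γ : V [⋀^Fin k]→L[ℝ] ℝ) :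
    hodgeStar o h (β + γ) = hodgeStar o h β + hodgeStar o h γ := by
  simp only [hodgeStar, ContinuousAlternatingMap.add_apply, add_smul, Finset.sum_add_distrib,
    smul_add]

theorem hodgeStar_smul {k l : ℕ} (h : k + l = n) (c : ℝ) (β : V [⋀^Fin k]→L[ℝ] ℝ) :
    hodgeStar o h (c • β) = c • hodgeStar o h β := by
  simp only [hodgeStar, ContinuousAlternatingMap.smul_apply, smul_assoc, ← Finset.smul_sum]
  rw [smul_comm]

/-- Because a♭ ∧ μ = 0, the covector a♭ can be moved from the arguments of ⋆β to the basis vectors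
inserted into μ. There, summing ⟨a, e_j⟩ e_j over the basis rebuilds a, which is what ι_a β needs.
-/
theorem wedgeCovector_hodgeStar {k l : ℕ} (h : k + 1 + l = n) (h' : k + (l + 1) = n) (a : V)
    (β : V [⋀^Fin (k + 1)]→L[ℝ] ℝ) :
    wedgeCovector (innerSL ℝ a) (hodgeStar o h β) =
      (-1 : ℝ) ^ k • hodgeStar o h' (β.curryLeft a) := by
  subst h
  have hV : finrank ℝ V = k + 1 + l := Fact.out
  set e := stdOrthonormalBasis ℝ V with he
  ext w
  have hL : wedgeCovector (innerSL ℝ a) (hodgeStar o rfl β) w =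
      ((k + 1)! : ℝ)⁻¹ * ∑ J : Fin (k + 1) → Fin (finrank ℝ V), β (e ∘ J) *
        ∑ i : Fin (l + 1), (-1 : ℝ) ^ (i : ℕ) *
          (innerSL ℝ a (w i) * volForm o (Fin.append (e ∘ J) (i.removeNth w))) := by
    simp only [wedgeCovector_eq, covectorWedge_apply, hodgeStar_apply, ← he]
    simp only [Finset.mul_sum, Finset.smul_sum]
    rw [Finset.sum_comm]
    refine Finset.sum_congr rfl fun J _ => Finset.sum_congr rfl fun i _ => ?_
    simp only [zsmul_eq_mul, smul_eq_mul, Int.cast_pow, Int.cast_neg, Int.cast_one]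
    have : ∀ u : Fin (k + 1 + l) → V, u ∘ Fin.cast rfl = u := fun u => rfl
    rw [this]
    ring
  rw [hL]
  simp only [sum_append_removeNth_top hV]
  simp only [ContinuousAlternatingMap.smul_apply, hodgeStar_apply, ← he, smul_eq_mul]
  -- Every slot b gives the same sum, once J is split into its entry at b and the rest. The
  -- resulting factor k + 1 turns 1/(k+1)! into 1/k!.
  have hR : ∀ b : Fin (k + 1), ∑ J : Fin (k + 1) → Fin (finrank ℝ V), β (e ∘ J) *
      ((-1 : ℝ) ^ (b : ℕ) * (innerSL ℝ a ((e ∘ J) b) *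
        volForm o (Fin.append (b.removeNth (e ∘ J)) w ∘
          Fin.cast (by omega : k + 1 + l = k + (l + 1))))) =
      ∑ J : Fin k → Fin (finrank ℝ V), β.curryLeft a (e ∘ J) *
        volForm o (Fin.append (e ∘ J) w ∘ Fin.cast h'.symm) := by
    intro b
    rw [← (Fin.insertNthEquiv (fun _ => Fin (finrank ℝ V)) b).sum_comp, Fintype.sum_prod_type,
      Finset.sum_comm]
    refine Finset.sum_congr rfl fun J _ => ?_
    have h1 : ∀ j, e ∘ (b.insertNth (α := fun _ => Fin (finrank ℝ V)) j J) =
        b.insertNth (α := fun _ => V) (e j) (e ∘ J) := fun j => by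
      ext1 i
      refine Fin.succAboveCases b ?_ (fun i => ?_) i <;> simp
    have h2 : ∀ j, (-1 : ℝ) ^ (b : ℕ) * β (b.insertNth (α := fun _ => V) (e j) (e ∘ J)) =
        β.curryLeft (e j) (e ∘ J) := fun j => by
      have := AlternatingMap.neg_one_pow_smul_map_insertNth β.toAlternatingMap b (e j) (e ∘ J)
      simpa using this
    have h3 : β.curryLeft a (e ∘ J) =
        ∑ j, inner ℝ a (e j) * β.curryLeft (e j) (e ∘ J) := by
      conv_lhs => rw [← e.sum_repr' a]
      simp only [map_sum, map_smul, ContinuousAlternatingMap.sum_apply,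
        ContinuousAlternatingMap.smul_apply, smul_eq_mul, real_inner_comm]
    rw [h3, Finset.sum_mul]
    refine Finset.sum_congr rfl fun j _ => ?_
    have h4 : Fin.insertNthEquiv (fun _ => Fin (finrank ℝ V)) b (j, J) =
        b.insertNth (α := fun _ => Fin (finrank ℝ V)) j J := rfl
    simp only [h4, h1, Fin.removeNth_insertNth, Fin.insertNth_apply_same,
      innerSL_apply_apply, ← h2]
    ring
  calc _ = ((k + 1)! : ℝ)⁻¹ * ((-1) ^ k * ∑ b : Fin (k + 1),
        ∑ J : Fin (k + 1) → Fin (finrank ℝ V), β (e ∘ J) *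
      ((-1 : ℝ) ^ (b : ℕ) * (innerSL ℝ a ((e ∘ J) b) *
        volForm o (Fin.append (b.removeNth (e ∘ J)) w ∘
          Fin.cast (by omega : k + 1 + l = k + (l + 1)))))) := by
        congr 1
        rw [Finset.sum_comm, Finset.mul_sum]
        refine Finset.sum_congr rfl fun J _ => ?_
        simp only [Finset.mul_sum]
        exact Finset.sum_congr rfl fun i _ => by ring
    _ = _ := by
        simp only [hR, Finset.sum_const, Finset.card_univ, Fintype.card_fin, nsmul_eq_mul,
          Nat.factorial_succ]
        have : ((k : ℝ) + 1) ≠ 0 := by positivity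
        have : (k ! : ℝ) ≠ 0 := by positivity
        push_cast
        field_simp

end Star

theorem append_update_left {V : Type*} {k l : ℕ} (u : Fin k → V) (w : Fin l → V) (i : Fin k)
    (c : V) :
    Fin.append (Function.update u i c) w =
      Function.update (Fin.append u w) (Fin.castAdd l i) c := by
  ext1 j
  refine Fin.addCases (fun j => ?_) (fun j => ?_) j
  · by_cases hj : j = i
    · subst hj; simp
    · rw [Function.update_of_ne fun h => hj (Fin.castAdd_injective _ _ h)]
      simp [Function.update_of_ne hj]
  · rw [Function.update_of_ne]
    · simp
    · intro h
      have := congrArg Fin.val h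
      have := i.isLt
      simp at *
      omega

/-! ### Bijectivity of `⋆_v`, the symbol of `δ_v`, and the star in a general basis. -/

section Star

variable {V : Type*} [NormedAddCommGroup V] [InnerProductSpace ℝ V] {n : ℕ}
  [Fact (finrank ℝ V = n)] (o : Orientation ℝ V (Fin n))

theorem volForm_apply (w : Fin n → V) : volForm o w = o.volumeForm w := rfl

theorem volForm_eq_det (b : Basis (Fin n) ℝ V) (w : Fin n → V) :
    volForm o w = volForm o b * b.det w := by
  have := congrArg (fun γ => γ w) (o.volumeForm.eq_smul_basis_det b)
  simpa [volForm_apply] using this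

variable [FiniteDimensional ℝ V]

theorem exists_volForm_ne_zero : ∃ w, volForm o w ≠ 0 := by
  have hV : finrank ℝ V = n := Fact.out
  let b := (stdOrthonormalBasis ℝ V).reindex (finCongr hV)
  refine ⟨b, fun h => ?_⟩
  have := o.abs_volumeForm_apply_of_orthonormal b
  rw [← volForm_apply, h] at this
  simp at this

/-- Induction on the degree: ⋆ι_a β = ± a♭ ∧ ⋆β vanishes for every a, so all contractions of β
vanish. In degree 0 the star multiplies the volume form, which is nonzero. -/
theorem eq_zero_of_hodgeStar_eq_zero {k l : ℕ} (h : k + l = n) {β : V [⋀^Fin k]→L[ℝ] ℝ}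
    (hβ : hodgeStar o h β = 0) : β = 0 := by
  induction k generalizing l with
  | zero =>
    obtain ⟨w, hw⟩ := exists_volForm_ne_zero o
    have h1 := congrArg (fun γ => γ (w ∘ Fin.cast (by omega : l = n))) hβ
    simp only [hodgeStar_apply, Finset.univ_unique, Finset.sum_singleton] at h1
    have h2 : (Fin.append (⇑(stdOrthonormalBasis ℝ V) ∘ (default : Fin 0 → _))
        (w ∘ Fin.cast (by omega : l = n)) ∘ Fin.cast h.symm) = w := by
      subst h
      ext1 j
      rw [Function.comp_apply, Subsingleton.elim (⇑(stdOrthonormalBasis ℝ V) ∘ _) Fin.elim0,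
        Fin.elim0_append]
      simp
    rw [h2] at h1
    ext u
    rw [Subsingleton.elim u (⇑(stdOrthonormalBasis ℝ V) ∘ default)]
    simpa [hw] using h1
  | succ k ih =>
    refine eq_zero_of_curryLeft_eq_zero fun a => ih (l := l + 1) (by omega) ?_
    have h1 := wedgeCovector_hodgeStar o h (by omega : k + (l + 1) = n) a β
    have h2 : wedgeCovector (innerSL ℝ a) (0 : V [⋀^Fin l]→L[ℝ] ℝ) = 0 := by
      rw [wedgeCovector_eq]; ext w; simp [covectorWedge_apply]
    rw [hβ, h2] at h1
    exact (smul_eq_zero.1 h1.symm).resolve_left (by simp)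

/-- The `v`-induced Hodge star as a linear map. -/
def hodgeStarVₗ (v : V) {k l : ℕ} (h : k + l = n) :
    (V [⋀^Fin k]→L[ℝ] ℝ) →ₗ[ℝ] (V [⋀^Fin l]→L[ℝ] ℝ) where
  toFun := hodgeStarV o v h
  map_add' β γ := by simp only [hodgeStarV, tMap_add, hodgeStar_add]
  map_smul' c β := by simp only [hodgeStarV, tMap_smul, hodgeStar_smul, RingHom.id_apply]

theorem hodgeStarVₗ_injective (v : V) {k l : ℕ} (h : k + l = n) :
    Function.Injective (hodgeStarVₗ o v h) :=
  (injective_iff_map_eq_zero _).2 fun _ hβ =>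
    eq_zero_of_tMap_eq_zero v (eq_zero_of_hodgeStar_eq_zero o h hβ)

/-- Injectivity in both directions, Λ^k → Λ^l and Λ^l → Λ^k, forces equal dimensions, so no binomial
count is needed. -/
theorem hodgeStarV_bijective (v : V) {k l : ℕ} (h : k + l = n) :
    Function.Bijective (hodgeStarV o v h) := by
  have h1 := hodgeStarVₗ_injective o v h
  have h2 := hodgeStarVₗ_injective o v (by omega : l + k = n)
  have h3 := le_antisymm (LinearMap.finrank_le_finrank_of_injective h1)
    (LinearMap.finrank_le_finrank_of_injective h2)
  exact ⟨h1, (LinearMap.injective_iff_surjective_of_finrank_eq_finrank h3).1 h1⟩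

theorem hodgeStarVInv_hodgeStarV (v : V) {k l : ℕ} (h : k + l = n) (β : V [⋀^Fin k]→L[ℝ] ℝ) :
    hodgeStarVInv o v h (hodgeStarV o v h β) = β :=
  Function.leftInverse_invFun (hodgeStarV_bijective o v h).1 β

theorem hodgeStarV_hodgeStarVInv (v : V) {k l : ℕ} (h : k + l = n) (γ : V [⋀^Fin l]→L[ℝ] ℝ) :
    hodgeStarV o v h (hodgeStarVInv o v h γ) = γ :=
  Function.rightInverse_invFun (hodgeStarV_bijective o v h).2 γ

theorem hodgeStarVInv_add (v : V) {k l : ℕ} (h : k + l = n) (γ γ' : V [⋀^Fin l]→L[ℝ] ℝ) :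
    hodgeStarVInv o v h (γ + γ') = hodgeStarVInv o v h γ + hodgeStarVInv o v h γ' := by
  refine (hodgeStarV_bijective o v h).1 ?_
  have := (hodgeStarVₗ o v h).map_add (hodgeStarVInv o v h γ) (hodgeStarVInv o v h γ')
  rw [hodgeStarV_hodgeStarVInv]
  refine Eq.trans ?_ this.symm
  exact congrArg₂ (· + ·) (hodgeStarV_hodgeStarVInv o v h γ).symm
    (hodgeStarV_hodgeStarVInv o v h γ').symm

theorem hodgeStarVInv_smul (v : V) {k l : ℕ} (h : k + l = n) (c : ℝ) (γ : V [⋀^Fin l]→L[ℝ] ℝ) :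
    hodgeStarVInv o v h (c • γ) = c • hodgeStarVInv o v h γ := by
  refine (hodgeStarV_bijective o v h).1 ?_
  have := (hodgeStarVₗ o v h).map_smul c (hodgeStarVInv o v h γ)
  rw [hodgeStarV_hodgeStarVInv]
  refine Eq.trans ?_ this.symm
  exact congrArg (c • ·) (hodgeStarV_hodgeStarVInv o v h γ).symm

/-- The principal symbol of `δ_v` at the covector `⟨a, ·⟩` is `-ι_{X_a}`. -/
theorem hodgeStarVInv_wedgeCovector (v a : V) {k l : ℕ} (h : k + 1 + l = n) (h' : k + (l + 1) = n)
    (β : V [⋀^Fin (k + 1)]→L[ℝ] ℝ) :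
    (-1 : ℝ) ^ (k + 1) • hodgeStarVInv o v h' (wedgeCovector (innerSL ℝ a) (hodgeStarV o v h β)) =
      -β.curryLeft (symbolVector v a) := by
  rw [hodgeStarV, wedgeCovector_hodgeStar o h h', curryLeft_tMap, ← hodgeStarV,
    hodgeStarVInv_smul, hodgeStarVInv_hodgeStarV, smul_smul, pow_succ, mul_right_comm, ← mul_pow]
  rw [neg_one_mul, neg_neg, one_pow, one_mul]
  exact neg_one_smul ℝ (β.curryLeft (symbolVector v a))

/-- The Hodge star in an arbitrary basis `b`, with `s` the metric duals of the coordinates. -/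
theorem hodgeStar_apply_basis {ι : Type*} [Fintype ι] (b : Basis ι ℝ V) (s : ι → V)
    (hs : ∀ i x, inner ℝ (s i) x = b.repr x i) {k l : ℕ} (h : k + l = n)
    (β : V [⋀^Fin k]→L[ℝ] ℝ) (w : Fin l → V) :
    hodgeStar o h β w = (k ! : ℝ)⁻¹ * ∑ J : Fin k → ι,
      β (b ∘ J) * volForm o (Fin.append (s ∘ J) w ∘ Fin.cast h.symm) := by
  classical
  rw [hodgeStar_apply]
  congr 1
  set e := stdOrthonormalBasis ℝ V
  -- the map that sends `u` to `μ(u, w)`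
  obtain ⟨Φ, hΦ⟩ : ∃ Φ : MultilinearMap ℝ (fun _ : Fin k => V) ℝ,
      ∀ u, Φ u = volForm o (Fin.append u w ∘ Fin.cast h.symm) := by
    subst h
    refine ⟨⟨fun u => volForm o (Fin.append u w), ?_, ?_⟩, fun u => rfl⟩
    · intro inst u i x y
      obtain rfl := Subsingleton.elim inst (instDecidableEqFin k)
      simp only [append_update_left]
      exact ContinuousAlternatingMap.map_update_add _ _ _ _ _
    · intro inst u i c x
      obtain rfl := Subsingleton.elim inst (instDecidableEqFin k)
      simp only [append_update_left]
      exact ContinuousAlternatingMap.map_update_smul _ _ _ _ _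
  simp only [← hΦ]
  -- The coefficients of e_j in `b` and those of s_i in `e` are the same numbers, transposed; hence
  -- both sums become one double sum.
  have h1 : ∀ J : Fin k → Fin (finrank ℝ V), β (e ∘ J) =
      ∑ K : Fin k → ι, (∏ i, b.repr (e (J i)) (K i)) * β (b ∘ K) := by
    intro J
    have : e ∘ J = fun i => ∑ m, b.repr (e (J i)) m • b m := by
      ext1 i; exact (b.sum_repr _).symm
    rw [this, ContinuousAlternatingMap.map_sum]
    refine Finset.sum_congr rfl fun K _ => ?_
    exact ContinuousAlternatingMap.map_smul_univ _ _ _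
  have h2 : ∀ K : Fin k → ι, Φ (s ∘ K) =
      ∑ J : Fin k → Fin (finrank ℝ V), (∏ i, b.repr (e (J i)) (K i)) * Φ (e ∘ J) := by
    intro K
    have : s ∘ K = fun i => ∑ m, b.repr (e m) (K i) • e m := by
      ext1 i
      simp only [← hs, Function.comp_apply]
      conv_lhs => rw [← e.sum_repr' (s (K i))]
      simp only [real_inner_comm]
    rw [this, MultilinearMap.map_sum]
    refine Finset.sum_congr rfl fun J _ => ?_
    exact MultilinearMap.map_smul_univ _ _ _
  simp only [h1, h2, Finset.sum_mul, Finset.mul_sum]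
  rw [Finset.sum_comm]
  exact Finset.sum_congr rfl fun K _ => Finset.sum_congr rfl fun J _ => by ring

/-- The Gram matrix is BᵀB, with B the coordinates of `b` in an orthonormal basis. This determines
the volume of a frame from the metric up to sign. -/
theorem volForm_basis_sq (b : Basis (Fin n) ℝ V) :
    volForm o b ^ 2 = (Matrix.of fun i j => inner ℝ (b i) (b j)).det := by
  have hV : finrank ℝ V = n := Fact.out
  let e := (stdOrthonormalBasis ℝ V).reindex (finCongr hV)
  rw [← sq_abs, volForm_apply, o.volumeForm_robust' e, sq_abs, Basis.det_apply, sq]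
  conv_lhs => enter [1]; rw [← Matrix.det_transpose]
  rw [← Matrix.det_mul]
  congr 1
  ext i j
  simp only [Matrix.mul_apply, Matrix.transpose_apply, Basis.toMatrix_apply,
    OrthonormalBasis.coe_toBasis_repr_apply, OrthonormalBasis.repr_apply_apply, Matrix.of_apply]
  rw [← e.sum_inner_mul_inner]
  simp only [real_inner_comm]

end Star

/-! ### Bounded solutions of a second order linear equation with constant coefficients -/

section ODE

variable {F : Type*} [NormedAddCommGroup F] [NormedSpace ℂ F]

theorem hasDerivAt_exp_smul (c : ℂ) (a : F) (t : ℝ) :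
    HasDerivAt (fun s : ℝ => Complex.exp (c * s) • a) (c • Complex.exp (c * t) • a) t := by
  have h1 : HasDerivAt (fun s : ℝ => c * (s : ℂ)) c t := by
    simpa using (Complex.ofRealCLM.hasDerivAt (x := t)).const_mul c
  have h2 := (h1.cexp).smul_const a
  rwa [mul_comm, ← smul_smul] at h2

theorem eq_exp_smul_of_hasDerivAt {w : ℝ → F} {c : ℂ} (hw : ∀ t, HasDerivAt w (c • w t) t) (t : ℝ) :
    w t = Complex.exp (c * t) • w 0 := by
  have h1 : ∀ s : ℝ, HasDerivAt (fun s : ℝ => Complex.exp (-c * s) • w s) 0 s := fun s => by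
    have h2 : HasDerivAt (fun s : ℝ => -c * (s : ℂ)) (-c) s := by
      simpa using (Complex.ofRealCLM.hasDerivAt (x := s)).const_mul (-c)
    refine (h2.cexp.smul (hw s)).congr_deriv ?_
    rw [smul_smul, ← add_smul]
    ring_nf
    simp
  have h3 := is_const_of_deriv_eq_zero (fun s => (h1 s).differentiableAt)
    (fun s => (h1 s).deriv) t 0
  simp only [Complex.ofReal_zero, mul_zero, Complex.exp_zero, one_smul] at h3
  rw [← h3, smul_smul, ← Complex.exp_add]
  simp

theorem norm_exp_mul_ofReal_smul (c : ℂ) (t : ℝ) (a : F) :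
    ‖Complex.exp (c * t) • a‖ = Real.exp (c.re * t) * ‖a‖ := by
  rw [norm_smul, Complex.norm_exp]
  simp

/-- If `Re p < 0 < Re q`, the solutions of `(d/dt - p)(d/dt - q) u = 0` which are bounded on
`[0, ∞)` are the multiples of `exp (p t)`. -/
theorem eq_exp_smul_of_bounded {u : ℝ → F} (hu : ContDiff ℝ ∞ u) {p q : ℂ} (hp : p.re < 0)
    (hq : 0 < q.re) (h : ∀ t, deriv (deriv u) t - (p + q) • deriv u t + (p * q) • u t = 0)
    {C : ℝ} (hC : ∀ t, 0 ≤ t → ‖u t‖ ≤ C) (t : ℝ) : u t = Complex.exp (p * t) • u 0 := by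
  have hu1 : ∀ t, HasDerivAt u (deriv u t) t := fun t =>
    (hu.differentiable (by simp) t).hasDerivAt
  have hu2 : ∀ t, HasDerivAt (deriv u) (deriv (deriv u) t) t := fun t =>
    ((contDiff_infty_iff_deriv.1 hu).2.differentiable (by simp) t).hasDerivAt
  -- Factorization of the equation: u' - p u solves w' = q w.
  have hw := eq_exp_smul_of_hasDerivAt (w := fun t => deriv u t - p • u t) (c := q) fun t => by
    refine ((hu2 t).sub ((hu1 t).const_smul p)).congr_deriv ?_
    rw [← sub_eq_zero, ← h t]
    module
  have hqp : q - p ≠ 0 := fun h0 => by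
    have := congrArg Complex.re h0
    simp at this
    linarith
  -- The coefficient of exp(qt) in u: once it is removed, a solution of z' = p z remains.
  -- Boundedness then forces d = 0, since Re q > 0.
  set d := (q - p)⁻¹ • (deriv u 0 - p • u 0) with hd
  have hz := eq_exp_smul_of_hasDerivAt (w := fun t => u t - Complex.exp (q * t) • d) (c := p)
    fun t => by
      refine ((hu1 t).sub (hasDerivAt_exp_smul q d t)).congr_deriv ?_
      have h1 := hw t
      have h2 : deriv u 0 - p • u 0 = (q - p) • d := by
        rw [hd, smul_smul, mul_inv_cancel₀ hqp, one_smul]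
      rw [h2] at h1
      rw [sub_eq_iff_eq_add.1 h1]
      module
  have hu' : ∀ t : ℝ, u t = Complex.exp (q * t) • d + Complex.exp (p * t) • (u 0 - d) := fun t => by
    have h1 := hz t
    simp only [Complex.ofReal_zero, mul_zero, Complex.exp_zero, one_smul] at h1
    rw [← h1]
    abel
  suffices hd0 : d = 0 by
    rw [hu' t, hd0]; simp
  by_contra hd0
  have hdpos : 0 < ‖d‖ := norm_pos_iff.2 hd0
  have hb : ∀ t, 0 ≤ t → Real.exp (q.re * t) ≤ (C + ‖u 0 - d‖) / ‖d‖ := fun t ht => by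
    rw [le_div_iff₀ hdpos, ← norm_exp_mul_ofReal_smul]
    have h1 : Complex.exp (q * t) • d = u t - Complex.exp (p * t) • (u 0 - d) := by
      rw [hu' t]; abel
    rw [h1]
    refine (norm_sub_le _ _).trans (add_le_add (hC t ht) ?_)
    rw [norm_exp_mul_ofReal_smul]
    refine mul_le_of_le_one_left (norm_nonneg _) (Real.exp_le_one_iff.2 ?_)
    exact mul_nonpos_of_nonpos_of_nonneg hp.le ht
  have hlim : Tendsto (fun t => Real.exp (q.re * t)) atTop atTop :=
    Real.tendsto_exp_atTop.comp (tendsto_id.const_mul_atTop hq)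
  obtain ⟨t, ht, ht'⟩ := ((hlim.eventually_gt_atTop ((C + ‖u 0 - d‖) / ‖d‖)).and
    (eventually_ge_atTop 0)).exists
  exact absurd (hb t ht') (not_le.2 ht)

/-- The bounded solutions of `q₀ u + 2 b D_t u + q₂ D_t² u = 0`, where `D_t = -i d/dt` and the
quadratic polynomial `q₀ + 2 b τ + q₂ τ²` has no real roots. -/
theorem exists_root_bounded_solutions {q₀ b q₂ : ℝ} (h₂ : 0 < q₂) (hD : 0 < q₂ * q₀ - b ^ 2) :
    ∃ τ : ℂ, 0 < τ.im ∧ ∀ u : ℝ → F, ContDiff ℝ ∞ u →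
      (((∀ t, (q₀ : ℂ) • u t + (2 * b * -Complex.I : ℂ) • deriv u t -
        (q₂ : ℂ) • deriv (deriv u) t = 0) ∧ ∃ C : ℝ, ∀ t, 0 ≤ t → ‖u t‖ ≤ C) ↔
      ∀ t : ℝ, u t = Complex.exp (Complex.I * τ * t) • u 0) := by
  set D := √(q₂ * q₀ - b ^ 2) with hDdef
  have hDpos : 0 < D := Real.sqrt_pos.2 hD
  have hDsq : (D : ℂ) ^ 2 = q₂ * q₀ - b ^ 2 := by
    rw [← Complex.ofReal_pow, Real.sq_sqrt hD.le]; push_cast; ring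
  have hq2 : (q₂ : ℂ) ≠ 0 := by exact_mod_cast h₂.ne'
  -- The root in the upper half plane. Then p = iτ has negative real part, while q is i times the
  -- conjugate root and has positive real part.
  set τ : ℂ := (-b + D * Complex.I) / q₂ with hτ
  set p : ℂ := Complex.I * τ with hp
  set q : ℂ := (-b * Complex.I + D) / q₂ with hq
  have hsum : q₂ * (p + q) = -2 * b * Complex.I := by
    rw [hp, hq, hτ]; field_simp; linear_combination (D : ℂ) * Complex.I_sq
  have hprod : q₂ * (p * q) = -q₀ := by
    have : q₂ * (q₂ * (p * q)) = q₂ * -q₀ := by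
      rw [hp, hq, hτ]; field_simp
      linear_combination (-hDsq) + (b ^ 2 + D ^ 2 - b * D * Complex.I : ℂ) * Complex.I_sq
    exact mul_left_cancel₀ hq2 this
  have hτim : τ.im = D / q₂ := by
    rw [hτ, Complex.div_ofReal_im]; simp
  have hpre : p.re = -(D / q₂) := by
    rw [hp]; simp [hτim]
  have hqre : q.re = D / q₂ := by
    rw [hq, Complex.div_ofReal_re]; simp
  have hDq : 0 < D / q₂ := div_pos hDpos h₂
  refine ⟨τ, hτim ▸ hDq, fun u hu => ⟨?_, ?_⟩⟩
  · rintro ⟨heq, C, hC⟩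
    refine eq_exp_smul_of_bounded hu (by rw [hpre]; linarith) (by rwa [hqre]) (fun t => ?_) hC
    have h1 : (q₂ : ℂ) • (deriv (deriv u) t - (p + q) • deriv u t + (p * q) • u t) = 0 := by
      rw [← neg_eq_zero, ← heq t, smul_add, smul_sub, smul_smul, smul_smul, hsum, hprod]
      module
    exact (smul_eq_zero.1 h1).resolve_left hq2
  · intro hexp
    have hu0 : u = fun t : ℝ => Complex.exp (p * t) • u 0 := funext hexp
    have hd1 : deriv u = fun t : ℝ => p • u t := by
      ext t
      rw [hexp t, hu0]
      simpa using (hasDerivAt_exp_smul p (u 0) t).deriv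
    have hd2 : ∀ t, deriv (deriv u) t = p • p • u t := fun t => by
      have := ((hu.differentiable (by simp) t).hasDerivAt.const_smul p).deriv
      rw [hd1] at this ⊢
      exact this
    refine ⟨fun t => ?_, ‖u 0‖, fun t ht => ?_⟩
    · rw [hd2, hd1]
      have h1 : (q₀ : ℂ) + 2 * b * -Complex.I * p - q₂ * p * p = 0 := by
        linear_combination hprod - p * hsum
      calc _ = ((q₀ : ℂ) + 2 * b * -Complex.I * p - q₂ * p * p) • u t := by module
        _ = 0 := by rw [h1, zero_smul]
    · rw [hexp t, norm_exp_mul_ofReal_smul]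
      refine mul_le_of_le_one_left (norm_nonneg _) (Real.exp_le_one_iff.2 ?_)
      exact mul_nonpos_of_nonpos_of_nonneg (by rw [hpre]; linarith) ht

theorem contDiff_exp_mul_smul (c : ℂ) (a : F) :
    ContDiff ℝ ∞ fun t : ℝ => Complex.exp (c * t) • a := by
  have h : ContDiff ℝ ∞ fun t : ℝ => Complex.exp (c * t) :=
    (contDiff_const.mul Complex.ofRealCLM.contDiff).cexp
  exact h.smul contDiff_const

end ODE

/-! ### Forms on a space split into a hyperplane and a line -/

section Split

variable {V F : Type*} [NormedAddCommGroup V] [NormedSpace ℝ V] [NormedAddCommGroup F]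
  [NormedSpace ℝ F]

/-- A form annihilated by `ι_N` does not change when multiples of `N` are subtracted from its
arguments. -/
theorem form_apply_sub_smul {k : ℕ} {γ : V [⋀^Fin k]→L[ℝ] F} {N : V}
    (h : ∀ w : Fin k → V, ∀ i, w i = N → γ w = 0) (α : V →L[ℝ] ℝ) (w : Fin k → V) :
    γ (fun i => w i - α (w i) • N) = γ w := by
  classical
  -- The arguments are altered one at a time; each change adds a term in which `N` occurs as an
  -- argument.
  have key : ∀ s : Finset (Fin k), γ (s.piecewise (fun i => w i - α (w i) • N) w) = γ w := by
    intro s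
    induction s using Finset.induction_on with
    | empty => simp
    | insert i s his ih =>
      rw [Finset.piecewise_insert, ContinuousAlternatingMap.map_update_sub,
        ContinuousAlternatingMap.map_update_smul, h (Function.update _ i N) i (by simp), smul_zero,
        sub_zero, ← ih]
      congr 1
      rw [Function.update_eq_self_iff]
      simp [his]
  simpa using key Finset.univ

theorem form_apply_eq_zero_of_curryLeft_eq_zero {k : ℕ} {γ : V [⋀^Fin (k + 1)]→L[ℝ] F} {N : V}
    (h : γ.curryLeft N = 0) (w : Fin (k + 1) → V) (i : Fin (k + 1)) (hi : w i = N) : γ w = 0 := by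
  have h1 := AlternatingMap.neg_one_pow_smul_map_insertNth γ.toAlternatingMap i N (i.removeNth w)
  have h2 : γ (Matrix.vecCons N (i.removeNth w)) = 0 :=
    congrArg (fun δ => δ (i.removeNth w)) h
  rw [← hi, Fin.insertNth_self_removeNth] at h1
  rw [← hi] at h2
  have h3 : (-1 : ℤ) ^ (i : ℕ) • γ w = 0 := h1.trans h2
  rcases neg_one_pow_eq_or ℤ (i : ℕ) with h4 | h4 <;> simpa [h4] using h3

variable {W : Submodule ℝ V} {ν : V →L[ℝ] ℝ} {N : V}

/-- The projection onto a hyperplane `W = ker ν` along a vector `N` with `ν N ≠ 0`. -/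
def projAlong (hW : W = LinearMap.ker ν.toLinearMap) (hN : ν N ≠ 0) : V →L[ℝ] W :=
  (ContinuousLinearMap.id ℝ V - ((ν N)⁻¹ • ν).smulRight N).codRestrict W fun x => by
    rw [hW]
    simp only [ContinuousLinearMap.coe_coe, LinearMap.mem_ker]
    simp
    field_simp
    simp

theorem coe_projAlong (hW : W = LinearMap.ker ν.toLinearMap) (hN : ν N ≠ 0) (x : V) :
    (projAlong hW hN x : V) = x - ((ν N)⁻¹ • ν) x • N := rfl

theorem projAlong_self (hW : W = LinearMap.ker ν.toLinearMap) (hN : ν N ≠ 0) :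
    projAlong hW hN N = 0 := by
  ext
  simp [coe_projAlong, hN]

theorem projAlong_coe (hW : W = LinearMap.ker ν.toLinearMap) (hN : ν N ≠ 0) (x : W) :
    projAlong hW hN x = x := by
  ext
  have : ν x = 0 := (hW ▸ x.2 : (x : V) ∈ LinearMap.ker ν.toLinearMap)
  simp [coe_projAlong, this]

/-- Restriction of forms to a subspace. -/
def restrictForm (W : Submodule ℝ V) {k : ℕ} (β : V [⋀^Fin k]→L[ℝ] F) : W [⋀^Fin k]→L[ℝ] F :=
  β.compContinuousLinearMap W.subtypeL

theorem eq_zero_of_restrictForm_eq_zero (hW : W = LinearMap.ker ν.toLinearMap) (hN : ν N ≠ 0)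
    {k : ℕ} {γ : V [⋀^Fin k]→L[ℝ] F} (h : ∀ w : Fin k → V, ∀ i, w i = N → γ w = 0)
    (h0 : restrictForm W γ = 0) : γ = 0 := by
  ext w
  rw [← form_apply_sub_smul h ((ν N)⁻¹ • ν)]
  exact congrArg (fun δ => δ (fun i => projAlong hW hN (w i))) h0

theorem existsUnique_form_restrict_zero (hW : W = LinearMap.ker ν.toLinearMap) (hN : ν N ≠ 0)
    (h : W [⋀^Fin 0]→L[ℝ] F) : ∃! β : V [⋀^Fin 0]→L[ℝ] F, restrictForm W β = h := by
  refine ⟨h.compContinuousLinearMap (projAlong hW hN), ?_, fun β hβ => ?_⟩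
  · ext w
    exact congrArg h (Subsingleton.elim _ _)
  · ext w
    rw [← hβ]
    exact congrArg β (Subsingleton.elim _ _)

/-- A form on `V = W ⊕ ℝ N` is determined by the restrictions of `β` and `ι_N β` to `W`, which can
be prescribed. -/
theorem existsUnique_form_restrict_succ (hW : W = LinearMap.ker ν.toLinearMap) (hN : ν N ≠ 0)
    {k : ℕ} (h : W [⋀^Fin (k + 1)]→L[ℝ] F) (g : W [⋀^Fin k]→L[ℝ] F) :
    ∃! β : V [⋀^Fin (k + 1)]→L[ℝ] F,
      restrictForm W β = h ∧ restrictForm W (β.curryLeft N) = g := by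
  refine existsUnique_of_exists_of_unique ?_ ?_
  · set prj := projAlong hW hN
    set α : V →L[ℝ] ℝ := (ν N)⁻¹ • ν with hα
    have hαN : α N = 1 := by simp [hα, hN]
    have hαW : ∀ x : W, α x = 0 := fun x => by
      have h' : ν x = 0 := (hW ▸ x.2 : (x : V) ∈ LinearMap.ker ν.toLinearMap)
      simp [hα, h']
    have hpg : ∀ l (g' : W [⋀^Fin l]→L[ℝ] F), restrictForm W (g'.compContinuousLinearMap prj) = g' :=
      fun l g' => by
        ext w
        refine congrArg g' (funext fun i => ?_)
        exact projAlong_coe hW hN (w i)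
    have hw0 : ∀ l (g' : V [⋀^Fin l]→L[ℝ] F), restrictForm W (covectorWedge α g') = 0 :=
      fun l g' => by
        ext w
        refine (covectorWedge_apply α g' _).trans (Finset.sum_eq_zero fun i _ => ?_)
        exact (congrArg (fun c : ℝ => (-1 : ℤ) ^ (i : ℕ) • c • g' _) (hαW (w i))).trans
          (by rw [zero_smul, smul_zero])
    have hc0 : ∀ l (g' : W [⋀^Fin (l + 1)]→L[ℝ] F),
        (g'.compContinuousLinearMap prj).curryLeft N = 0 := fun l g' => by
      ext w
      refine ContinuousAlternatingMap.map_coord_zero g' 0 ?_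
      exact projAlong_self hW hN
    have hwN : (covectorWedge α (g.compContinuousLinearMap prj)).curryLeft N =
        g.compContinuousLinearMap prj := by
      cases k with
      | zero => rw [curryLeft_covectorWedge_zero, hαN, one_smul]
      | succ k =>
        rw [curryLeft_covectorWedge_succ, hαN, one_smul, hc0]
        have : covectorWedge α (0 : V [⋀^Fin k]→L[ℝ] F) = 0 := by
          ext w; simp [covectorWedge_apply]
        rw [this, sub_zero]
    -- The first summand is killed by ι_N and restricts to `h`; the second restricts to 0, and ι_N
    -- recovers `g` from it because α N = 1.
    refine ⟨h.compContinuousLinearMap prj + covectorWedge α (g.compContinuousLinearMap prj), ?_, ?_⟩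
    · calc _ = restrictForm W (h.compContinuousLinearMap prj) +
          restrictForm W (covectorWedge α (g.compContinuousLinearMap prj)) := rfl
        _ = h := by rw [hpg, hw0, add_zero]
    · rw [ContinuousAlternatingMap.curryLeft_add, add_apply, hc0, hwN, zero_add, hpg]
  · rintro β β' ⟨h1, h2⟩ ⟨h1', h2'⟩
    rw [← sub_eq_zero]
    have hd1 : restrictForm W (β - β') = 0 := by
      calc _ = restrictForm W β - restrictForm W β' := rfl
        _ = 0 := by rw [h1, h1', sub_self]
    have hd2 : restrictForm W ((β - β').curryLeft N) = 0 := by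
      calc _ = restrictForm W (β.curryLeft N) - restrictForm W (β'.curryLeft N) := rfl
        _ = 0 := by rw [h2, h2', sub_self]
    -- A form annihilated by ι_N is determined by its restriction to `W`. This is used first for the
    -- contraction of the difference, then for the difference itself.
    have hd3 : (β - β').curryLeft N = 0 := by
      refine eq_zero_of_restrictForm_eq_zero hW hN (fun w i hi => ?_) hd2
      cases k with
      | zero => exact i.elim0
      | succ k =>
        exact form_apply_eq_zero_of_curryLeft_eq_zero
          (ContinuousAlternatingMap.curryLeft_same _ N) w i hi
    exact eq_zero_of_restrictForm_eq_zero hW hN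
      (form_apply_eq_zero_of_curryLeft_eq_zero hd3) hd1

/-- Complex version of `existsUnique_form_restrict_succ`: the vector transversal to `W` is the
complex vector `X + τ N`. -/
theorem existsUnique_form_restrict_complex (hW : W = LinearMap.ker ν.toLinearMap) (hN : ν N ≠ 0)
    {k : ℕ} (X : V) {τ : ℂ} (hτ : 0 < τ.im) (h : W [⋀^Fin (k + 1)]→L[ℝ] ℂ)
    (g : W [⋀^Fin k]→L[ℝ] ℂ) :
    ∃! β : V [⋀^Fin (k + 1)]→L[ℝ] ℂ, restrictForm W β = h ∧
      restrictForm W (β.curryLeft X) + τ • restrictForm W (β.curryLeft N) = g := by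
  -- The component of X + τ N along `N` modulo the complexification of `W`; its imaginary part is Im
  -- τ, so it is invertible.
  set c : ℂ := ((ν N)⁻¹ * ν X : ℝ) + τ with hc
  have hc0 : c ≠ 0 := fun h0 => by
    have := congrArg Complex.im h0
    simp [hc] at this
    linarith
  have hX : X = projAlong hW hN X + ((ν N)⁻¹ * ν X) • N := by
    rw [coe_projAlong]; simp
  have key : ∀ β : V [⋀^Fin (k + 1)]→L[ℝ] ℂ,
      restrictForm W (β.curryLeft X) + τ • restrictForm W (β.curryLeft N) =
      (restrictForm W β).curryLeft (projAlong hW hN X) + c • restrictForm W (β.curryLeft N) := by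
    intro β
    have h1 : restrictForm W (β.curryLeft (projAlong hW hN X : V)) =
        (restrictForm W β).curryLeft (projAlong hW hN X) := by
      ext w
      refine congrArg β (funext fun i => ?_)
      refine Fin.cases rfl (fun i => rfl) i
    have h2 : β.curryLeft X = β.curryLeft (projAlong hW hN X : V) +
        ((ν N)⁻¹ * ν X) • β.curryLeft N := by
      conv_lhs => rw [hX]
      rw [map_add, map_smul]
    rw [h2, ← h1]
    ext w
    simp only [restrictForm, hc, ContinuousAlternatingMap.add_apply,
      ContinuousAlternatingMap.smul_apply, ContinuousAlternatingMap.compContinuousLinearMap_apply,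
      smul_eq_mul, Complex.real_smul]
    ring
  -- The part of X in `W` contributes a contraction of the prescribed restriction `h`, so it is
  -- subtracted before dividing by c.
  obtain ⟨β, ⟨hβ1, hβ2⟩, hβu⟩ := existsUnique_form_restrict_succ hW hN h
    (c⁻¹ • (g - h.curryLeft (projAlong hW hN X)))
  refine ⟨β, ⟨hβ1, ?_⟩, fun β' hβ' => hβu β' ⟨hβ'.1, ?_⟩⟩
  · rw [key, hβ1, hβ2, smul_smul, mul_inv_cancel₀ hc0, one_smul]
    abel
  · rw [← hβ'.2, key, hβ'.1, add_sub_cancel_left, smul_smul, inv_mul_cancel₀ hc0, one_smul]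

end Split

/-! ### The symbols of `δ_v` and `Δ_v`, and the model boundary value problem -/

section Symbols

variable {V : Type*} [NormedAddCommGroup V] [InnerProductSpace ℝ V]

/-- Interior multiplication by a vector. -/
def contraction {k : ℕ} (X : V) : (V [⋀^Fin (k + 1)]→L[ℝ] ℝ) →ₗ[ℝ] (V [⋀^Fin k]→L[ℝ] ℝ) where
  toFun β := β.curryLeft X
  map_add' _ _ := rfl
  map_smul' _ _ := rfl

/-- Restriction of real forms to a subspace, as a linear map. -/
def restrictFormₗ (W : Submodule ℝ V) {k : ℕ} :
    (V [⋀^Fin k]→L[ℝ] ℝ) →ₗ[ℝ] (W [⋀^Fin k]→L[ℝ] ℝ) where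
  toFun := restrictForm W
  map_add' _ _ := rfl
  map_smul' _ _ := rfl

theorem contraction_apply {k : ℕ} (X : V) (β : V [⋀^Fin (k + 1)]→L[ℝ] ℝ) :
    contraction X β = β.curryLeft X := rfl

theorem restrictFormₗ_apply (W : Submodule ℝ V) {k : ℕ} (β : V [⋀^Fin k]→L[ℝ] ℝ) :
    restrictFormₗ W β = restrictForm W β := rfl

theorem isSymbolExpansion_restrict (W : Submodule ℝ V) {k : ℕ} (ξ ν : V →L[ℝ] ℝ) :
    IsSymbolExpansion 0 (fun _ => restrictFormₗ W (k := k)) ξ ν (fun _ => restrictFormₗ W) := by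
  intro τ
  simp

theorem complexify_smul_id {k : ℕ} (c : ℝ) (u : V [⋀^Fin k]→L[ℝ] ℂ) :
    complexify (c • LinearMap.id) u = (c : ℂ) • u := by
  ext w
  apply Complex.ext <;> simp [complexify]

theorem complexify_restrict (W : Submodule ℝ V) {k : ℕ} (u : V [⋀^Fin k]→L[ℝ] ℂ) :
    complexify (restrictFormₗ W) u = restrictForm W u := by
  ext w
  apply Complex.ext <;> simp [complexify, restrictFormₗ_apply, restrictForm]

variable [FiniteDimensional ℝ V]

/-- The vector that represents a covector by the inner product. -/
def sharp : (V →L[ℝ] ℝ) →ₗ[ℝ] V where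
  toFun ξ := ∑ i, ξ (stdOrthonormalBasis ℝ V i) • stdOrthonormalBasis ℝ V i
  map_add' ξ η := by simp [add_smul, Finset.sum_add_distrib]
  map_smul' c ξ := by simp [Finset.smul_sum, smul_smul]

theorem inner_sharp (ξ : V →L[ℝ] ℝ) (x : V) : inner ℝ (sharp ξ) x = ξ x := by
  conv_rhs => rw [← (stdOrthonormalBasis ℝ V).sum_repr' x]
  simp only [sharp, LinearMap.coe_mk, AddHom.coe_mk, sum_inner, real_inner_smul_left, map_sum,
    map_smul, smul_eq_mul]
  exact Finset.sum_congr rfl fun i _ => mul_comm _ _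

theorem innerSL_sharp (ξ : V →L[ℝ] ℝ) : innerSL ℝ (sharp ξ) = ξ := by
  ext x
  exact inner_sharp ξ x

/-- The vector `X_ξ = ξ♯ + ξ(v) v`, depending linearly on the covector `ξ`. -/
def covectorVector (v : V) : (V →L[ℝ] ℝ) →ₗ[ℝ] V := symbolVector v ∘ₗ sharp

/-- The pairing (ξ, η) ↦ η(X_ξ) is the dual metric plus v ⊗ v, hence again an inner product on
covectors. -/
theorem apply_covectorVector (v : V) (ξ η : V →L[ℝ] ℝ) :
    η (covectorVector v ξ) = inner ℝ (sharp η) (sharp ξ) + ξ v * η v := by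
  rw [covectorVector, LinearMap.comp_apply, symbolVector_apply, map_add, map_smul, inner_sharp,
    real_inner_comm, inner_sharp, smul_eq_mul]

theorem apply_covectorVector_comm (v : V) (ξ η : V →L[ℝ] ℝ) :
    η (covectorVector v ξ) = ξ (covectorVector v η) := by
  rw [apply_covectorVector, apply_covectorVector, real_inner_comm, mul_comm]

theorem apply_covectorVector_self_pos (v : V) {ξ : V →L[ℝ] ℝ} (hξ : ξ ≠ 0) :
    0 < ξ (covectorVector v ξ) := by
  rw [apply_covectorVector]
  have h : sharp ξ ≠ 0 := fun h => hξ (by rw [← innerSL_sharp ξ, h, map_zero])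
  have := real_inner_self_pos.2 h
  nlinarith [mul_self_nonneg (ξ v)]

/-- The principal symbol of `Δ_v`: multiplication by `-ξ(X_ξ) = -(|ξ|² + ξ(v)²)`. -/
def laplacianSymbol (v : V) {k : ℕ} (ξ : V →L[ℝ] ℝ) :
    (V [⋀^Fin k]→L[ℝ] ℝ) →ₗ[ℝ] (V [⋀^Fin k]→L[ℝ] ℝ) :=
  (-ξ (covectorVector v ξ)) • LinearMap.id

theorem laplacianSymbol_bijective (v : V) {k : ℕ} {ξ : V →L[ℝ] ℝ} (hξ : ξ ≠ 0) :
    Function.Bijective (laplacianSymbol v (k := k) ξ) := by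
  have h : -ξ (covectorVector v ξ) ≠ 0 := (neg_lt_zero.2 (apply_covectorVector_self_pos v hξ)).ne
  refine ⟨fun β γ hβγ => ?_, fun β => ⟨(-ξ (covectorVector v ξ))⁻¹ • β, ?_⟩⟩
  · exact smul_right_injective _ h hβγ
  · exact smul_inv_smul₀ h β

/-- The coefficients of `τ ↦ σ_{Δ_v}(ξ + τ ν)`. -/
def laplacianCoeff (v : V) {k : ℕ} (ξ ν : V →L[ℝ] ℝ) :
    Fin 3 → ((V [⋀^Fin k]→L[ℝ] ℝ) →ₗ[ℝ] (V [⋀^Fin k]→L[ℝ] ℝ)) :=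
  ![(-ξ (covectorVector v ξ)) • LinearMap.id, (-(2 * ν (covectorVector v ξ))) • LinearMap.id,
    (-ν (covectorVector v ν)) • LinearMap.id]

theorem isSymbolExpansion_laplacian (v : V) {k : ℕ} (ξ ν : V →L[ℝ] ℝ) :
    IsSymbolExpansion 2 (laplacianSymbol v (k := k)) ξ ν (laplacianCoeff v ξ ν) := by
  intro τ
  refine Eq.trans ?_ (Fin.sum_univ_three _).symm
  simp only [laplacianSymbol, laplacianCoeff, map_add, map_smul, add_apply, smul_apply,
    smul_eq_mul, apply_covectorVector_comm v ν ξ]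
  simp
  module

/-- The principal symbol of `ω ↦ j^*(δ_v ω)`. -/
def codiffSymbol (W : Submodule ℝ V) (v : V) {k : ℕ} (ξ : V →L[ℝ] ℝ) :
    (V [⋀^Fin (k + 1)]→L[ℝ] ℝ) →ₗ[ℝ] (W [⋀^Fin k]→L[ℝ] ℝ) :=
  -(restrictFormₗ W ∘ₗ contraction (covectorVector v ξ))

/-- The coefficients of the principal symbol of `ω ↦ j^*(δ_v ω)` at `ξ + τ ν`. -/
def codiffCoeff (W : Submodule ℝ V) (v : V) {k : ℕ} (ξ ν : V →L[ℝ] ℝ) :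
    Fin 2 → ((V [⋀^Fin (k + 1)]→L[ℝ] ℝ) →ₗ[ℝ] (W [⋀^Fin k]→L[ℝ] ℝ)) :=
  ![codiffSymbol W v ξ, codiffSymbol W v ν]

theorem isSymbolExpansion_codiff (W : Submodule ℝ V) (v : V) {k : ℕ} (ξ ν : V →L[ℝ] ℝ) :
    IsSymbolExpansion 1 (codiffSymbol W v (k := k)) ξ ν (codiffCoeff W v ξ ν) := by
  intro τ
  refine Eq.trans ?_ (Fin.sum_univ_two _).symm
  ext β w
  simp [codiffCoeff, codiffSymbol, contraction_apply, restrictFormₗ_apply, restrictForm]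
  ring

theorem complexify_codiffSymbol (W : Submodule ℝ V) (v : V) {k : ℕ} (ξ : V →L[ℝ] ℝ)
    (u : V [⋀^Fin (k + 1)]→L[ℝ] ℂ) :
    complexify (codiffSymbol W v ξ) u = -restrictForm W (u.curryLeft (covectorVector v ξ)) := by
  ext w
  apply Complex.ext <;> simp [complexify, codiffSymbol, restrictFormₗ_apply, restrictForm,
    contraction_apply]

theorem symbolODE_laplacian (v : V) {k : ℕ} (ξ ν : V →L[ℝ] ℝ)
    (u : ℝ → V [⋀^Fin k]→L[ℝ] ℂ) (t : ℝ) :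
    symbolODE (laplacianCoeff v ξ ν) u t =
      -((ξ (covectorVector v ξ) : ℂ) • u t +
        (2 * ν (covectorVector v ξ) * -Complex.I : ℂ) • deriv u t -
        (ν (covectorVector v ν) : ℂ) • deriv (deriv u) t) := by
  refine (Fin.sum_univ_three _).trans ?_
  simp only [laplacianCoeff, Matrix.cons_val_zero, Matrix.cons_val_one, Matrix.cons_val,
    complexify_smul_id]
  simp [iteratedDeriv_succ, iteratedDeriv_zero]
  module

/-- Strict Cauchy–Schwarz for this inner product: positivity is applied to q₂ ξ - b ν, which is
nonzero because it does not vanish on w. -/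
theorem discriminant_pos (v : V) {ξ ν : V →L[ℝ] ℝ} (h : ∃ w, ν w = 0 ∧ ξ w ≠ 0) (hν : ν ≠ 0) :
    0 < ν (covectorVector v ν) * ξ (covectorVector v ξ) - ν (covectorVector v ξ) ^ 2 := by
  obtain ⟨w, hw, hw'⟩ := h
  have hq := apply_covectorVector_self_pos v hν
  set q₂ := ν (covectorVector v ν)
  set b := ν (covectorVector v ξ) with hb
  have hne : q₂ • ξ - b • ν ≠ 0 := fun h0 => by
    have := congrArg (fun η : V →L[ℝ] ℝ => η w) h0
    simp [hw, hw', hq.ne'] at this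
  have h1 := apply_covectorVector_self_pos v hne
  have h2 : (q₂ • ξ - b • ν) (covectorVector v (q₂ • ξ - b • ν)) =
      q₂ * (q₂ * ξ (covectorVector v ξ) - b ^ 2) := by
    simp only [map_sub, map_smul, sub_apply, smul_apply, smul_eq_mul,
      apply_covectorVector_comm v ν ξ, ← hb]
    ring
  rw [h2] at h1
  exact (mul_pos_iff_of_pos_left hq).1 h1

/-- Bounded solutions of the model equation correspond to their values at `0`; `τ` is the root of
`σ_{Δ_v}(ξ + τ ν)` in the upper half plane. -/
theorem existsUnique_solution_of_boundary (v : V) {k : ℕ} {ξ ν : V →L[ℝ] ℝ}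
    (h : ∃ w, ν w = 0 ∧ ξ w ≠ 0) (hν : ν ≠ 0)
    (P : (V [⋀^Fin k]→L[ℝ] ℂ) → (V [⋀^Fin k]→L[ℝ] ℂ) → Prop)
    (hP : ∀ τ : ℂ, 0 < τ.im → ∃! β, P β ((Complex.I * τ) • β)) :
    ∃! u : ℝ → V [⋀^Fin k]→L[ℝ] ℂ, ContDiff ℝ ∞ u ∧
      (∀ t, symbolODE (laplacianCoeff v ξ ν) u t = 0) ∧ (∃ C : ℝ, ∀ t, 0 ≤ t → ‖u t‖ ≤ C) ∧
      P (u 0) (deriv u 0) := by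
  obtain ⟨τ, hτ, H⟩ := exists_root_bounded_solutions (F := V [⋀^Fin k]→L[ℝ] ℂ)
    (apply_covectorVector_self_pos v hν) (discriminant_pos v h hν)
  have H' : ∀ u : ℝ → V [⋀^Fin k]→L[ℝ] ℂ, ContDiff ℝ ∞ u →
      (((∀ t, symbolODE (laplacianCoeff v ξ ν) u t = 0) ∧
        ∃ C : ℝ, ∀ t, 0 ≤ t → ‖u t‖ ≤ C) ↔
      ∀ t : ℝ, u t = Complex.exp (Complex.I * τ * t) • u 0) := by
    intro u hu
    simp only [symbolODE_laplacian, neg_eq_zero]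
    exact H u hu
  -- On bounded solutions D_t acts as multiplication by τ, so first order boundary conditions become
  -- algebraic in u(0).
  have hderiv : ∀ u : ℝ → V [⋀^Fin k]→L[ℝ] ℂ,
      (∀ t : ℝ, u t = Complex.exp (Complex.I * τ * t) • u 0) →
      deriv u 0 = (Complex.I * τ) • u 0 := fun u hu => by
    have h1 := (hasDerivAt_exp_smul (Complex.I * τ) (u 0) 0).deriv
    rw [← funext hu] at h1
    simpa using h1
  obtain ⟨β, hβ, hβu⟩ := hP τ hτ
  have hexp : ∀ t : ℝ, (fun t : ℝ => Complex.exp (Complex.I * τ * t) • β) t =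
      Complex.exp (Complex.I * τ * t) • (fun t : ℝ => Complex.exp (Complex.I * τ * t) • β) 0 :=
    fun t => by simp
  have h0 : (fun t : ℝ => Complex.exp (Complex.I * τ * t) • β) 0 = β := by simp
  refine ⟨fun t : ℝ => Complex.exp (Complex.I * τ * t) • β, ?_, ?_⟩
  · have hc := contDiff_exp_mul_smul (Complex.I * τ) β
    obtain ⟨h1, h2⟩ := (H' _ hc).2 hexp
    refine ⟨hc, h1, h2, ?_⟩
    rw [hderiv _ hexp]
    simpa only [h0] using hβ
  · rintro u ⟨hu, h1, h2, h3⟩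
    have h4 := (H' u hu).1 ⟨h1, h2⟩
    rw [hderiv u h4] at h3
    ext1 t
    rw [h4 t, hβu _ h3]

theorem existsUnique_solution_zero (v : V) {W : Submodule ℝ V} {ξ ν : V →L[ℝ] ℝ}
    (hW : W = LinearMap.ker ν.toLinearMap) (hξ : ∃ w ∈ W, ξ w ≠ 0) (hν : ν ≠ 0)
    (h : W [⋀^Fin 0]→L[ℝ] ℂ) :
    ∃! u : ℝ → V [⋀^Fin 0]→L[ℝ] ℂ, ContDiff ℝ ∞ u ∧
      (∀ t, symbolODE (laplacianCoeff v ξ ν) u t = 0) ∧ (∃ C : ℝ, ∀ t, 0 ≤ t → ‖u t‖ ≤ C) ∧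
      symbolODE (m := 0) (fun _ => restrictFormₗ W) u 0 = h := by
  have hN : ν (covectorVector v ν) ≠ 0 := (apply_covectorVector_self_pos v hν).ne'
  have hξ' : ∃ w, ν w = 0 ∧ ξ w ≠ 0 := by
    obtain ⟨w, hw, hw'⟩ := hξ
    exact ⟨w, by rw [hW] at hw; exact hw, hw'⟩
  have hS : ∀ u : ℝ → V [⋀^Fin 0]→L[ℝ] ℂ,
      symbolODE (m := 0) (fun _ => restrictFormₗ W) u 0 = restrictForm W (u 0) := fun u => by
    simp [symbolODE, complexify_restrict]
  simp only [hS]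
  exact existsUnique_solution_of_boundary v hξ' hν (fun β _ => restrictForm W β = h)
    fun _ _ => existsUnique_form_restrict_zero hW hN h

/-- With u'(0) = iτ u(0), the second condition reads -j^*(ι_{X_ξ + τ X_ν} u(0)) = g. Here X_ν is
transversal to `W`, as ν(X_ν) > 0. -/
theorem existsUnique_solution_succ (v : V) {W : Submodule ℝ V} {ξ ν : V →L[ℝ] ℝ}
    (hW : W = LinearMap.ker ν.toLinearMap) (hξ : ∃ w ∈ W, ξ w ≠ 0) (hν : ν ≠ 0) {k : ℕ}
    (h : W [⋀^Fin (k + 1)]→L[ℝ] ℂ) (g : W [⋀^Fin k]→L[ℝ] ℂ) :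
    ∃! u : ℝ → V [⋀^Fin (k + 1)]→L[ℝ] ℂ, ContDiff ℝ ∞ u ∧
      (∀ t, symbolODE (laplacianCoeff v ξ ν) u t = 0) ∧ (∃ C : ℝ, ∀ t, 0 ≤ t → ‖u t‖ ≤ C) ∧
      symbolODE (m := 0) (fun _ => restrictFormₗ W) u 0 = h ∧
      symbolODE (codiffCoeff W v ξ ν) u 0 = g := by
  have hN : ν (covectorVector v ν) ≠ 0 := (apply_covectorVector_self_pos v hν).ne'
  have hξ' : ∃ w, ν w = 0 ∧ ξ w ≠ 0 := by
    obtain ⟨w, hw, hw'⟩ := hξ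
    exact ⟨w, by rw [hW] at hw; exact hw, hw'⟩
  have hS : ∀ u : ℝ → V [⋀^Fin (k + 1)]→L[ℝ] ℂ,
      symbolODE (m := 0) (fun _ => restrictFormₗ W) u 0 = restrictForm W (u 0) := fun u => by
    simp [symbolODE, complexify_restrict]
  have hS' : ∀ u : ℝ → V [⋀^Fin (k + 1)]→L[ℝ] ℂ, symbolODE (codiffCoeff W v ξ ν) u 0 =
      -restrictForm W ((u 0).curryLeft (covectorVector v ξ)) +
        Complex.I • restrictForm W ((deriv u 0).curryLeft (covectorVector v ν)) := fun u => by
    refine (Fin.sum_univ_two _).trans ?_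
    simp [codiffCoeff, complexify_codiffSymbol, iteratedDeriv_one]
  simp only [hS, hS']
  refine existsUnique_solution_of_boundary v hξ' hν (fun β β' => restrictForm W β = h ∧
    -restrictForm W (β.curryLeft (covectorVector v ξ)) +
        Complex.I • restrictForm W (β'.curryLeft (covectorVector v ν)) = g) fun τ hτ => ?_
  have key : ∀ β : V [⋀^Fin (k + 1)]→L[ℝ] ℂ,
      -restrictForm W (β.curryLeft (covectorVector v ξ)) +
        Complex.I • restrictForm W (((Complex.I * τ) • β).curryLeft (covectorVector v ν)) =
      -(restrictForm W (β.curryLeft (covectorVector v ξ)) +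
        τ • restrictForm W (β.curryLeft (covectorVector v ν))) := fun β => by
    have h1 : restrictForm W (((Complex.I * τ) • β).curryLeft (covectorVector v ν)) =
      (Complex.I * τ) • restrictForm W (β.curryLeft (covectorVector v ν)) := rfl
    rw [h1, smul_smul, ← mul_assoc, Complex.I_mul_I, neg_add]
    congr 1
    rw [neg_one_mul]
    exact neg_smul τ (restrictForm W (β.curryLeft (covectorVector v ν)))
  simp only [key, neg_eq_iff_eq_neg]
  exact existsUnique_form_restrict_complex hW hN _ hτ h (-g)

end Symbols

/-! ### Expressions of forms in charts -/

section Charts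

variable {n : ℕ} [NeZero n] {M : Type*} [TopologicalSpace M]
  [ChartedSpace (EuclideanHalfSpace n) M]

/-- The form `η` is smooth at `x`, in the chart around `x`. -/
def SmoothFormAt {k : ℕ} (x : M) (η : DForm n M k) : Prop :=
  ContDiffWithinAt ℝ ∞ (chartRep x η) (range (𝓡∂ n)) (extChartAt (𝓡∂ n) x x)

theorem IsSmoothForm.smoothFormAt {k : ℕ} {η : DForm n M k} (hη : IsSmoothForm η) (x : M) :
    SmoothFormAt x η :=
  (hη x _ (mem_extChartAt_target x)).mono_of_mem_nhdsWithin (extChartAt_target_mem_nhdsWithin x)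

theorem uniqueDiffOn_range : UniqueDiffOn ℝ (range (𝓡∂ n)) := (𝓡∂ n).uniqueDiffOn

theorem extChartAt_mem_range (x y : M) : extChartAt (𝓡∂ n) x y ∈ range (𝓡∂ n) := by
  simp [extChartAt]

theorem eventually_symm_extChartAt {x : M} {p : M → Prop} (hp : ∀ᶠ y in 𝓝 x, p y) :
    ∀ᶠ z in 𝓝[range (𝓡∂ n)] (extChartAt (𝓡∂ n) x x), p ((extChartAt (𝓡∂ n) x).symm z) := by
  rw [← map_extChartAt_symm_nhdsWithin_range (I := 𝓡∂ n) x] at hp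
  exact hp

theorem form_apply_congr {k : ℕ} (η : DForm n M k) {p q : M} (h : p = q)
    (w w' : Fin k → EuclideanSpace ℝ (Fin n)) (hw : w = w') :
    η p (fun i => (w i : TangentSpace (𝓡∂ n) p)) = η q (fun i => (w' i : TangentSpace (𝓡∂ n) q)) := by
  subst h hw
  rfl

theorem SmoothFormAt.add {k : ℕ} {x : M} {η θ : DForm n M k} (hη : SmoothFormAt x η)
    (hθ : SmoothFormAt x θ) : SmoothFormAt x (fun y => η y + θ y) :=
  ContDiffWithinAt.add hη hθ

theorem SmoothFormAt.const_smul {k : ℕ} {x : M} {η : DForm n M k} (c : ℝ)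
    (hη : SmoothFormAt x η) : SmoothFormAt x (fun y => c • η y) :=
  ContDiffWithinAt.const_smul c hη

theorem contDiffWithinAt_chart_function {f : M → ℝ} (hf : ContMDiff (𝓡∂ n) 𝓘(ℝ, ℝ) ∞ f) (x : M) :
    ContDiffWithinAt ℝ ∞ (f ∘ (extChartAt (𝓡∂ n) x).symm) (range (𝓡∂ n))
      (extChartAt (𝓡∂ n) x x) := by
  exact (contMDiffAt_iff.1 (hf x)).2

theorem SmoothFormAt.smul {k : ℕ} {x : M} {η : DForm n M k} (hη : SmoothFormAt x η) {f : M → ℝ}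
    (hf : ContMDiff (𝓡∂ n) 𝓘(ℝ, ℝ) ∞ f) : SmoothFormAt x (fun y => f y • η y) :=
  ContDiffWithinAt.smul (contDiffWithinAt_chart_function hf x) hη

theorem mfderiv_eq_fderivWithin {f : M → ℝ} (hf : ContMDiff (𝓡∂ n) 𝓘(ℝ, ℝ) ∞ f) (x : M) :
    mfderiv (𝓡∂ n) 𝓘(ℝ, ℝ) f x = fderivWithin ℝ (f ∘ (extChartAt (𝓡∂ n) x).symm)
      (range (𝓡∂ n)) (extChartAt (𝓡∂ n) x x) := by
  have h : MDifferentiableAt (𝓡∂ n) 𝓘(ℝ, ℝ) f x := hf.mdifferentiableAt (by simp)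
  rw [h.mfderiv]
  rfl

variable [IsManifold (𝓡∂ n) ∞ M]

theorem chartRep_comp_mfderiv {k : ℕ} {x y : M} (hy : y ∈ (extChartAt (𝓡∂ n) x).source)
    (η : DForm n M k) (w : Fin k → EuclideanSpace ℝ (Fin n)) :
    chartRep x η (extChartAt (𝓡∂ n) x y) (fun i =>
      mfderiv (𝓡∂ n) 𝓘(ℝ, EuclideanSpace ℝ (Fin n)) (extChartAt (𝓡∂ n) x) y (w i)) = η y w := by
  have h := mfderivWithin_extChartAt_symm_comp_mfderiv_extChartAt' (I := 𝓡∂ n) hy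
  refine form_apply_congr η ((extChartAt (𝓡∂ n) x).left_inv hy) _ w (funext fun i => ?_)
  exact congrArg (fun L : TangentSpace (𝓡∂ n) y →L[ℝ] TangentSpace (𝓡∂ n) y => L (w i)) h

theorem chartRep_self {k : ℕ} (x : M) (η : DForm n M k) :
    chartRep x η (extChartAt (𝓡∂ n) x x) = η x := by
  refine ContinuousAlternatingMap.ext fun w => ?_
  have h := chartRep_comp_mfderiv (mem_extChartAt_source (I := 𝓡∂ n) x) η w
  rw [mfderiv_extChartAt_self] at h
  exact h

theorem dExt_eq {k : ℕ} (x : M) (η : DForm n M k) :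
    dExt η x = extDerivWithin (chartRep x η) (range (𝓡∂ n)) (extChartAt (𝓡∂ n) x x) := by
  rw [dExt, mfderiv_extChartAt_self]
  rfl

/-- `dExt` uses at each point y the chart around y, so its expression in the fixed chart around x
has to be compared across charts. This is naturality of the exterior derivative under the coordinate
change. -/
theorem chartRep_dExt_of_differentiableWithinAt {k : ℕ} {x : M} {η : DForm n M k}
    {z : EuclideanSpace ℝ (Fin n)} (hz : z ∈ (extChartAt (𝓡∂ n) x).target)
    (hη : DifferentiableWithinAt ℝ (chartRep x η) (range (𝓡∂ n)) z) :
    chartRep x (dExt η) z = extDerivWithin (chartRep x η) (range (𝓡∂ n)) z := by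
  set ex := extChartAt (𝓡∂ n) x with hex
  set y := ex.symm z with hy
  set ey := extChartAt (𝓡∂ n) y with hey
  have hyex : y ∈ ex.source := ex.map_target hz
  have hyey : y ∈ ey.source := mem_extChartAt_source y
  have hxy : ex y = z := ex.right_inv hz
  have heyy : ey.symm (ey y) = y := ey.left_inv hyey
  set tr : EuclideanSpace ℝ (Fin n) → EuclideanSpace ℝ (Fin n) := ex ∘ ey.symm with htr
  have htrey : tr (ey y) = z := by rw [htr, Function.comp_apply, heyy, hxy]
  have htrd : ContDiffWithinAt ℝ ∞ tr (range (𝓡∂ n)) (ey y) := by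
    refine contDiffWithinAt_ext_coord_change x y ?_
    rw [PartialEquiv.trans_source]
    exact ⟨ey.map_source hyey, by rw [mem_preimage]; rwa [heyy]⟩
  -- the differential of the coordinate change
  have hfd : ∀ z' ∈ ey.target, ey.symm z' ∈ ex.source → ∀ w : EuclideanSpace ℝ (Fin n),
      fderivWithin ℝ tr (range (𝓡∂ n)) z' w =
        mfderiv (𝓡∂ n) 𝓘(ℝ, EuclideanSpace ℝ (Fin n)) ex (ey.symm z')
          (mfderivWithin 𝓘(ℝ, EuclideanSpace ℝ (Fin n)) (𝓡∂ n) ey.symm (range (𝓡∂ n)) z' w) := by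
    intro z' hz' hzex w
    have h1 : MDifferentiableAt (𝓡∂ n) 𝓘(ℝ, EuclideanSpace ℝ (Fin n)) ex (ey.symm z') :=
      mdifferentiableAt_extChartAt (by rwa [hex, extChartAt_source] at hzex)
    have h2 : MDifferentiableWithinAt 𝓘(ℝ, EuclideanSpace ℝ (Fin n)) (𝓡∂ n) ey.symm
        (range (𝓡∂ n)) z' := mdifferentiableWithinAt_extChartAt_symm hz'
    have h3 : UniqueMDiffWithinAt 𝓘(ℝ, EuclideanSpace ℝ (Fin n)) (range (𝓡∂ n)) z' :=
      (uniqueDiffOn_range _ (extChartAt_target_subset_range y hz')).uniqueMDiffWithinAt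
    have h := mfderiv_comp_mfderivWithin z' h1 h2 h3
    rw [mfderivWithin_eq_fderivWithin] at h
    exact congrArg (fun L : EuclideanSpace ℝ (Fin n) →L[ℝ] EuclideanSpace ℝ (Fin n) => L w) h
  -- Near y, the expression of η in the chart around y is the pullback by the coordinate change of
  -- its expression in the chart around x.
  have hrep : chartRep y η =ᶠ[𝓝[range (𝓡∂ n)] (ey y)] fun z' =>
      (chartRep x η (tr z')).compContinuousLinearMap (fderivWithin ℝ tr (range (𝓡∂ n)) z') := by
    have hnear : ∀ᶠ y' in 𝓝 y, y' ∈ ex.source := extChartAt_source_mem_nhds' hyex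
    filter_upwards [extChartAt_target_mem_nhdsWithin y, eventually_symm_extChartAt hnear]
      with z' hz' hzex
    ext w
    refine (chartRep_comp_mfderiv hzex η _).symm.trans ?_
    exact congrArg (chartRep x η (tr z')) (funext fun i => (hfd z' hz' hzex (w i)).symm)
  have hpull := extDerivWithin_pullback (r := ∞) (t := range (𝓡∂ n)) (f := tr) (x := ey y)
    (show DifferentiableWithinAt ℝ (chartRep x η) (range (𝓡∂ n)) (tr (ey y)) by rwa [htrey]) htrd
    (by rw [minSmoothness_of_isRCLikeNormedField]; exact ENat.LEInfty.out) uniqueDiffOn_range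
    ((𝓡∂ n).range_subset_closure_interior (extChartAt_mem_range y y)) (extChartAt_mem_range y y)
    (fun z' _ => extChartAt_mem_range x (ey.symm z'))
  have hd : dExt η y = (extDerivWithin (chartRep x η) (range (𝓡∂ n)) z).compContinuousLinearMap
      (fderivWithin ℝ tr (range (𝓡∂ n)) (ey y)) := by
    rw [dExt_eq, hrep.extDerivWithin_eq_of_mem (extChartAt_mem_range y y), hpull, htrey]
  have hid : ∀ u : EuclideanSpace ℝ (Fin n), mfderivWithin 𝓘(ℝ, EuclideanSpace ℝ (Fin n)) (𝓡∂ n)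
      ey.symm (range (𝓡∂ n)) (ey y) u = u := by
    intro u
    have h := mfderivWithin_extChartAt_symm_comp_mfderiv_extChartAt' (I := 𝓡∂ n) hyey
    rw [mfderiv_extChartAt_self] at h
    exact congrArg (fun L : EuclideanSpace ℝ (Fin n) →L[ℝ] EuclideanSpace ℝ (Fin n) => L u) h
  have hbase : ∀ {p q : M} (_ : p = q) (u u' : EuclideanSpace ℝ (Fin n)) (_ : u = u'),
      (mfderiv (𝓡∂ n) 𝓘(ℝ, EuclideanSpace ℝ (Fin n)) ex p u : EuclideanSpace ℝ (Fin n)) =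
        mfderiv (𝓡∂ n) 𝓘(ℝ, EuclideanSpace ℝ (Fin n)) ex q u' := by
    rintro p q rfl u u' rfl
    rfl
  have hinv := mfderiv_extChartAt_comp_mfderivWithin_extChartAt_symm (I := 𝓡∂ n) hz
  refine ContinuousAlternatingMap.ext fun w => ?_
  refine (congrArg (fun β : EuclideanSpace ℝ (Fin n) [⋀^Fin (k + 1)]→L[ℝ] ℝ => β fun i =>
      mfderivWithin 𝓘(ℝ, EuclideanSpace ℝ (Fin n)) (𝓡∂ n) ex.symm (range (𝓡∂ n)) z (w i)) hd).trans
    (congrArg (extDerivWithin (chartRep x η) (range (𝓡∂ n)) z) (funext fun i => ?_))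
  refine (hfd (ey y) (ey.map_source hyey) (by rwa [heyy]) _).trans ?_
  refine (hbase heyy _ _ (hid _)).trans ?_
  exact congrArg (fun L : EuclideanSpace ℝ (Fin n) →L[ℝ] EuclideanSpace ℝ (Fin n) => L (w i)) hinv

theorem SmoothFormAt.eventually_chartRep_dExt {k : ℕ} {x : M} {η : DForm n M k}
    (hη : SmoothFormAt x η) :
    chartRep x (dExt η) =ᶠ[𝓝[range (𝓡∂ n)] (extChartAt (𝓡∂ n) x x)]
      extDerivWithin (chartRep x η) (range (𝓡∂ n)) := by
  -- Only finite order regularity at a point spreads to a neighbourhood; order 1 suffices.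
  have h1 : ContDiffWithinAt ℝ 1 (chartRep x η) (range (𝓡∂ n)) (extChartAt (𝓡∂ n) x x) :=
    hη.of_le (by exact_mod_cast le_top)
  have h2 := h1.eventually (by simp)
  rw [insert_eq_of_mem (extChartAt_mem_range x x)] at h2
  filter_upwards [extChartAt_target_mem_nhdsWithin x, h2] with z hz hz'
  exact chartRep_dExt_of_differentiableWithinAt hz (hz'.differentiableWithinAt (by simp))

theorem SmoothFormAt.dExt {k : ℕ} {x : M} {η : DForm n M k} (hη : SmoothFormAt x η) :
    SmoothFormAt x (dExt η) := by
  have h1 : ContDiffWithinAt ℝ ∞ (fderivWithin ℝ (chartRep x η) (range (𝓡∂ n)))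
      (range (𝓡∂ n)) (extChartAt (𝓡∂ n) x x) :=
    ContDiffWithinAt.fderivWithin_right hη uniqueDiffOn_range (by simp) (extChartAt_mem_range x x)
  have hL : ContDiff ℝ ∞ (ContinuousAlternatingMap.alternatizeUncurryFinCLM ℝ
      (EuclideanSpace ℝ (Fin n)) ℝ (n := k)) := by fun_prop
  have h2 : ContDiffWithinAt ℝ ∞ (extDerivWithin (chartRep x η) (range (𝓡∂ n)))
      (range (𝓡∂ n)) (extChartAt (𝓡∂ n) x x) := hL.comp_contDiffWithinAt h1
  exact h2.congr_of_eventuallyEq_of_mem hη.eventually_chartRep_dExt (extChartAt_mem_range x x)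

variable [RiemannianBundle (fun x : M => TangentSpace (𝓡∂ n) x)]

/-- The Leibniz rule `d(f η) = df ∧ η + f dη`. -/
theorem dExt_smul {k : ℕ} {x : M} {η : DForm n M k} (hη : SmoothFormAt x η) {f : M → ℝ}
    (hf : ContMDiff (𝓡∂ n) 𝓘(ℝ, ℝ) ∞ f) :
    dExt (fun y => f y • η y) x =
      wedgeCovector (mfderiv (𝓡∂ n) 𝓘(ℝ, ℝ) f x) (η x) + f x • dExt η x := by
  have hF := (contDiffWithinAt_chart_function hf x).differentiableWithinAt (by simp)
  have h := fderivWithin_smul (uniqueDiffOn_range _ (extChartAt_mem_range x x)) hF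
    (hη.differentiableWithinAt (by simp))
  have h1 : dExt (fun y => f y • η y) x = ContinuousAlternatingMap.alternatizeUncurryFin
      (fderivWithin ℝ ((f ∘ (extChartAt (𝓡∂ n) x).symm) • chartRep x η) (range (𝓡∂ n))
        (extChartAt (𝓡∂ n) x x)) := dExt_eq _ _
  have h2 : dExt (fun y => f y • η y) x =
      (f ∘ (extChartAt (𝓡∂ n) x).symm) (extChartAt (𝓡∂ n) x x) •
        extDerivWithin (chartRep x η) (range (𝓡∂ n)) (extChartAt (𝓡∂ n) x x) +
      ContinuousAlternatingMap.alternatizeUncurryFin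
        ((fderivWithin ℝ (f ∘ (extChartAt (𝓡∂ n) x).symm) (range (𝓡∂ n))
          (extChartAt (𝓡∂ n) x x)).smulRight (chartRep x η (extChartAt (𝓡∂ n) x x))) := by
    rw [h1, h, ContinuousAlternatingMap.alternatizeUncurryFin_add,
      ContinuousAlternatingMap.alternatizeUncurryFin_smul]
    rfl
  refine h2.trans ((add_comm _ _).trans (congrArg₂ (· + ·) ?_ ?_))
  · refine ContinuousAlternatingMap.ext fun w => ?_
    refine (covectorWedge_apply _ _ _).trans (Eq.trans ?_ (covectorWedge_apply _ _ _).symm)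
    rw [mfderiv_eq_fderivWithin hf, chartRep_self]
    rfl
  · rw [Function.comp_apply, extChartAt_to_inv, dExt_eq x η]
    rfl

end Charts

/-! ### The Hodge star in coordinates -/

section Coordinates

variable {V : Type*} [NormedAddCommGroup V] [InnerProductSpace ℝ V] {n : ℕ}

/-- The Gram matrix of a basis. -/
def gram (b : Basis (Fin n) ℝ V) : Matrix (Fin n) (Fin n) ℝ :=
  Matrix.of fun i j => inner ℝ (b i) (b j)

theorem tMap_succ_apply_basis (b : Basis (Fin n) ℝ V) (v : V) {k : ℕ}
    (β : V [⋀^Fin (k + 1)]→L[ℝ] ℝ) (J : Fin (k + 1) → Fin n) :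
    tMap v β (b ∘ J) = β (b ∘ J) + ∑ i : Fin (k + 1), (-1 : ℤ) ^ (i : ℕ) •
      ((∑ m, b.repr v m * gram b m (J i)) *
        ∑ m, b.repr v m * β (b ∘ (Fin.cons m (i.removeNth J) : Fin (k + 1) → Fin n))) := by
  rw [tMap, wedgeCovector_eq, ContinuousAlternatingMap.add_apply, covectorWedge_apply]
  congr 1
  refine Finset.sum_congr rfl fun i _ => ?_
  rw [smul_eq_mul]
  congr 2
  · rw [innerSL_apply_apply]
    have hv : inner ℝ v (b (J i)) = inner ℝ (∑ m, b.repr v m • b m) (b (J i)) :=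
      congrArg (inner ℝ · (b (J i))) (b.sum_repr v).symm
    refine hv.trans ?_
    rw [sum_inner]
    exact Finset.sum_congr rfl fun m _ => real_inner_smul_left _ _ _
  · have hv : β.curryLeft v = ∑ m, b.repr v m • β.curryLeft (b m) := by
      conv_lhs => rw [← b.sum_repr v]
      simp only [map_sum, map_smul]
    rw [hv, ContinuousAlternatingMap.sum_apply]
    refine Finset.sum_congr rfl fun m _ => ?_
    rw [ContinuousAlternatingMap.smul_apply, smul_eq_mul,
      ContinuousAlternatingMap.curryLeft_apply_apply]
    congr 2
    ext1 j
    refine Fin.cases ?_ (fun j => ?_) j <;> simp [Fin.removeNth]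

variable [Fact (finrank ℝ V = n)] [FiniteDimensional ℝ V] (o : Orientation ℝ V (Fin n))

theorem det_gram (b : Basis (Fin n) ℝ V) : (gram b).det = volForm o b ^ 2 :=
  (volForm_basis_sq o b).symm

theorem volForm_basis_ne_zero (b : Basis (Fin n) ℝ V) : volForm o b ≠ 0 := by
  obtain ⟨w, hw⟩ := exists_volForm_ne_zero o
  rw [volForm_eq_det o b] at hw
  exact left_ne_zero_of_mul hw

/-- The coordinate matrix of the vectors `b^{J₁}, …, b^{J_k}, b_{K₁}, …, b_{K_l}`, where
`b^1, …, b^n` is the reciprocal basis of `b`. -/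
def starMatrix (G : Matrix (Fin n) (Fin n) ℝ) {k l : ℕ} (h : k + l = n) (J : Fin k → Fin n)
    (K : Fin l → Fin n) : Matrix (Fin n) (Fin n) ℝ :=
  Matrix.of fun a c => Fin.append (fun i => G⁻¹ (J i) a)
    (fun j => (1 : Matrix (Fin n) (Fin n) ℝ) (K j) a) (Fin.cast h.symm c)

/-- The defining formula uses an orthonormal basis chosen separately in each tangent space, which
need not vary smoothly. Here only the Gram matrix, the volume of `b` and the coefficients of β
enter. -/
theorem hodgeStar_apply_basis_eq_det (b : Basis (Fin n) ℝ V) {k l : ℕ} (h : k + l = n)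
    (β : V [⋀^Fin k]→L[ℝ] ℝ) (K : Fin l → Fin n) :
    hodgeStar o h β (b ∘ K) = (k ! : ℝ)⁻¹ * ∑ J : Fin k → Fin n,
      β (b ∘ J) * (volForm o b * (starMatrix (gram b) h J K).det) := by
  have hdet : IsUnit (gram b).det := by
    rw [det_gram o]
    exact (pow_ne_zero 2 (volForm_basis_ne_zero o b)).isUnit
  rw [hodgeStar_apply_basis o b (fun i => ∑ m, (gram b)⁻¹ i m • b m)]
  · congr 1
    refine Finset.sum_congr rfl fun J _ => ?_
    rw [volForm_eq_det o b, Basis.det_apply]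
    congr 3
    ext a c
    rw [Basis.toMatrix_apply, starMatrix, Matrix.of_apply, Function.comp_apply]
    generalize Fin.cast h.symm c = c'
    refine Fin.addCases (fun i => ?_) (fun j => ?_) c'
    · simp [Finsupp.single_apply]
    · simp [Finsupp.single_apply, Matrix.one_apply]
  · intro i x
    conv_lhs => rw [← b.sum_repr x]
    have : ∀ j, ∑ m, (gram b)⁻¹ i m * inner ℝ (b m) (b j) =
        (1 : Matrix (Fin n) (Fin n) ℝ) i j := by
      intro j
      rw [← Matrix.nonsing_inv_mul _ hdet, Matrix.mul_apply]
      rfl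
    simp only [inner_sum, sum_inner, real_inner_smul_left, inner_smul_right, this,
      Matrix.one_apply]
    simp

end Coordinates

/-! ### Smoothness of determinants and inverse matrices. -/

section SmoothFunctions

variable {E : Type*} [NormedAddCommGroup E] [NormedSpace ℝ E] {H : Type*} [TopologicalSpace H]
  {I : ModelWithCorners ℝ E H} {N : Type*} [TopologicalSpace N] [ChartedSpace H N] {x : N}

theorem contMDiffAt_matrix_det {ι : Type*} [Fintype ι] [DecidableEq ι] {A : N → Matrix ι ι ℝ}
    (hA : ∀ i j, ContMDiffAt I 𝓘(ℝ, ℝ) ∞ (fun y => A y i j) x) :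
    ContMDiffAt I 𝓘(ℝ, ℝ) ∞ (fun y => (A y).det) x := by
  simp only [Matrix.det_apply']
  refine ContMDiffAt.sum fun s _ => contMDiffAt_const.mul ?_
  exact contMDiffAt_finsetProd fun i _ => hA _ _

/-- Cramer's rule. -/
theorem contMDiffAt_matrix_inv {ι : Type*} [Fintype ι] [DecidableEq ι] {A : N → Matrix ι ι ℝ}
    (hA : ∀ i j, ContMDiffAt I 𝓘(ℝ, ℝ) ∞ (fun y => A y i j) x) (h : (A x).det ≠ 0) (i j : ι) :
    ContMDiffAt I 𝓘(ℝ, ℝ) ∞ (fun y => (A y)⁻¹ i j) x := by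
  simp only [Matrix.inv_def, Ring.inverse_eq_inv', Matrix.smul_apply, smul_eq_mul,
    Matrix.adjugate_apply]
  refine ((contMDiffAt_matrix_det hA).inv₀ h).mul (contMDiffAt_matrix_det fun a c => ?_)
  by_cases ha : a = j
  · subst ha
    simp only [Matrix.updateRow_self]
    exact contMDiffAt_const
  · simp only [Matrix.updateRow_ne ha]
    exact hA a c

end SmoothFunctions

/-! ### Smoothness of the `v`-induced star operators -/

section SmoothStar

/-- A vector-valued map is smooth if its composition with an injective linear map on a
finite-dimensional space is smooth. -/
theorem contDiffWithinAt_of_injective_comp {X F G : Type*} [NormedAddCommGroup X]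
    [NormedSpace ℝ X] [NormedAddCommGroup F] [NormedSpace ℝ F] [FiniteDimensional ℝ F]
    [NormedAddCommGroup G] [NormedSpace ℝ G] [FiniteDimensional ℝ G] {r : ℕ∞ω} {L : F →ₗ[ℝ] G}
    (hL : Function.Injective L) {f : X → F} {s : Set X} {z : X}
    (hf : ContDiffWithinAt ℝ r (fun y => L (f y)) s z) : ContDiffWithinAt ℝ r f s z := by
  obtain ⟨L', hL'⟩ := L.exists_leftInverse_of_injective (LinearMap.ker_eq_bot.2 hL)
  have h := (LinearMap.toContinuousLinearMap L').contDiff.comp_contDiffWithinAt (n := r) hf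
  have hid : (LinearMap.toContinuousLinearMap L' ∘ fun y => L (f y)) = f :=
    funext fun y => congrArg (fun A : F →ₗ[ℝ] F => A (f y)) hL'
  rwa [hid] at h

/-- The coefficient functions of forms on a normed space in a basis. -/
def formCoeffs {n : ℕ} {V : Type*} [NormedAddCommGroup V] [NormedSpace ℝ V]
    (b : Basis (Fin n) ℝ V) (k : ℕ) : (V [⋀^Fin k]→L[ℝ] ℝ) →ₗ[ℝ] ((Fin k → Fin n) → ℝ) where
  toFun β J := β (b ∘ J)
  map_add' _ _ := rfl
  map_smul' _ _ := rfl

theorem formCoeffs_injective {n : ℕ} {V : Type*} [NormedAddCommGroup V] [NormedSpace ℝ V]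
    (b : Basis (Fin n) ℝ V) (k : ℕ) : Function.Injective (formCoeffs b k) := by
  rw [← LinearMap.ker_eq_bot, LinearMap.ker_eq_bot']
  intro β hβ
  have h : β.toAlternatingMap = 0 := Basis.ext_alternating b fun J _ => congrFun hβ J
  exact ContinuousAlternatingMap.ext fun w => congrArg (fun A : V [⋀^Fin k]→ₗ[ℝ] ℝ => A w) h

variable {n : ℕ} [NeZero n] {M : Type*} [TopologicalSpace M]
  [ChartedSpace (EuclideanHalfSpace n) M]

variable (n) in
/-- The standard basis of `ℝⁿ`. -/
abbrev stdBasis : Basis (Fin n) ℝ (EuclideanSpace ℝ (Fin n)) :=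
  (EuclideanSpace.basisFun (Fin n) ℝ).toBasis

/-- Moves the test of smoothness to coefficient functions on `M`, where smoothness of frames and of
the metric is available. -/
theorem smoothFormAt_of_contMDiffAt {k : ℕ} {x : M} {η : DForm n M k}
    (h : ∀ J : Fin k → Fin n, ContMDiffAt (𝓡∂ n) 𝓘(ℝ, ℝ) ∞
      (fun y => chartRep x η (extChartAt (𝓡∂ n) x y) (stdBasis n ∘ J)) x) :
    SmoothFormAt x η := by
  refine contDiffWithinAt_of_injective_comp (formCoeffs_injective (stdBasis n) k) ?_
  refine contDiffWithinAt_pi.2 fun J => ?_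
  have h1 := (contMDiffAt_iff.1 (h J)).2
  refine ContDiffWithinAt.congr_of_eventuallyEq_of_mem h1 ?_ (extChartAt_mem_range x x)
  filter_upwards [extChartAt_target_mem_nhdsWithin x] with z hz
  simp only [Function.comp_apply, (extChartAt (𝓡∂ n) x).right_inv hz]
  rfl

theorem contMDiffAt_chartRep {k : ℕ} {x : M} {η : DForm n M k} (hη : SmoothFormAt x η)
    (w : Fin k → EuclideanSpace ℝ (Fin n)) :
    ContMDiffAt (𝓡∂ n) 𝓘(ℝ, ℝ) ∞ (fun y => chartRep x η (extChartAt (𝓡∂ n) x y) w) x := by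
  have h1 : ContMDiffWithinAt 𝓘(ℝ, EuclideanSpace ℝ (Fin n)) 𝓘(ℝ, ℝ) ∞
      (fun z => chartRep x η z w) (range (𝓡∂ n)) (extChartAt (𝓡∂ n) x x) := by
    refine ContDiffWithinAt.contMDiffWithinAt ?_
    exact ((ContinuousAlternatingMap.apply ℝ _ ℝ w).contDiff (n := ∞)).comp_contDiffWithinAt hη
  rw [← contMDiffWithinAt_univ]
  exact h1.comp x (contMDiffAt_extChartAt (n := ∞)).contMDiffWithinAt
    fun y _ => extChartAt_mem_range x y

variable [IsManifold (𝓡∂ n) ∞ M]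

/-- The trivialization of the tangent bundle by the chart around `x`. -/
abbrev chartTriv (x : M) : Trivialization (EuclideanSpace ℝ (Fin n))
    (TotalSpace.proj : TangentBundle (𝓡∂ n) M → M) :=
  trivializationAt (EuclideanSpace ℝ (Fin n)) (TangentSpace (𝓡∂ n)) x

theorem mem_chartTriv_baseSet {x y : M} (hy : y ∈ (extChartAt (𝓡∂ n) x).source) :
    y ∈ (chartTriv (n := n) x).baseSet := by
  rw [extChartAt_source] at hy
  exact hy

/-- The coordinate frame of the chart around `x`. -/
def chartFrame (x : M) {y : M} (hy : y ∈ (extChartAt (𝓡∂ n) x).source) :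
    Basis (Fin n) ℝ (TangentSpace (𝓡∂ n) y) :=
  (chartTriv x).basisAt (stdBasis n) (mem_chartTriv_baseSet hy)

theorem mfderiv_chartFrame (x : M) {y : M} (hy : y ∈ (extChartAt (𝓡∂ n) x).source) (i : Fin n) :
    mfderiv (𝓡∂ n) 𝓘(ℝ, EuclideanSpace ℝ (Fin n)) (extChartAt (𝓡∂ n) x) y (chartFrame x hy i) =
      stdBasis n i := by
  rw [← TangentBundle.continuousLinearMapAt_trivializationAt (by simpa using hy)]
  refine (congrFun ((chartTriv x).coe_linearMapAt_of_mem (R := ℝ)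
    (mem_chartTriv_baseSet hy)) _).trans ?_
  exact ((chartTriv x).linearEquivAt (R := ℝ) y (mem_chartTriv_baseSet hy)).apply_symm_apply _

theorem chartRep_apply_stdBasis {k : ℕ} {x y : M} (hy : y ∈ (extChartAt (𝓡∂ n) x).source)
    (η : DForm n M k) (J : Fin k → Fin n) :
    chartRep x η (extChartAt (𝓡∂ n) x y) (stdBasis n ∘ J) = η y (chartFrame x hy ∘ J) := by
  refine Eq.trans ?_ (chartRep_comp_mfderiv hy η (chartFrame x hy ∘ J))
  exact congrArg _ (funext fun i => (mfderiv_chartFrame x hy (J i)).symm)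

theorem localFrame_eq_chartFrame {x y : M} (hy : y ∈ (extChartAt (𝓡∂ n) x).source) (i : Fin n) :
    (chartTriv x).localFrame (stdBasis n) i y = chartFrame x hy i :=
  (chartTriv x).localFrame_apply_of_mem_baseSet (stdBasis n) (mem_chartTriv_baseSet hy)

/-- The coefficients of the vector field `v` in the coordinate frame of the chart around `x`. -/
def frameCoeff (x : M) (v : ∀ x : M, TangentSpace (𝓡∂ n) x) (i : Fin n) (y : M) : ℝ :=
  (chartTriv x).localFrameCoeff (𝓡∂ n) (stdBasis n) i y (v y)

theorem frameCoeff_eq {x y : M} (hy : y ∈ (extChartAt (𝓡∂ n) x).source)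
    (v : ∀ x : M, TangentSpace (𝓡∂ n) x) (i : Fin n) :
    frameCoeff x v i y = (chartFrame x hy).repr (v y) i :=
  (chartTriv x).localFrameCoeff_apply_of_mem_baseSet (stdBasis n) (mem_chartTriv_baseSet hy) v i

theorem contMDiffAt_frameCoeff {v : ∀ x : M, TangentSpace (𝓡∂ n) x}
    (hv : ContMDiff (𝓡∂ n) (𝓡∂ n).tangent ∞ (fun x => (⟨x, v x⟩ : TangentBundle (𝓡∂ n) M)))
    (x : M) (i : Fin n) : ContMDiffAt (𝓡∂ n) 𝓘(ℝ, ℝ) ∞ (frameCoeff x v i) x :=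
  contMDiffAt_localFrameCoeff (stdBasis n)
    (mem_chartTriv_baseSet (mem_extChartAt_source x)) (hv x) i

variable [RiemannianBundle (fun x : M => TangentSpace (𝓡∂ n) x)]

/-- The Gram matrix of the coordinate frame of the chart around `x`. -/
def frameGram (x y : M) : Matrix (Fin n) (Fin n) ℝ := Matrix.of fun i j =>
  inner ℝ ((chartTriv x).localFrame (stdBasis n) i y) ((chartTriv x).localFrame (stdBasis n) j y)

theorem frameGram_eq {x y : M} (hy : y ∈ (extChartAt (𝓡∂ n) x).source) :
    frameGram x y = gram (chartFrame x hy) := by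
  ext i j
  simp only [frameGram, gram, Matrix.of_apply, localFrame_eq_chartFrame hy]

theorem contMDiffAt_frameGram [IsContMDiffRiemannianBundle (𝓡∂ n) ∞ (EuclideanSpace ℝ (Fin n))
      (fun x : M => TangentSpace (𝓡∂ n) x)] (x : M) (i j : Fin n) :
    ContMDiffAt (𝓡∂ n) 𝓘(ℝ, ℝ) ∞ (fun y => frameGram x y i j) x := by
  have h := fun i : Fin n => contMDiffAt_localFrame_of_mem (I := 𝓡∂ n) ∞ (chartTriv x)
    (stdBasis n) i (mem_chartTriv_baseSet (mem_extChartAt_source x))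
  exact (h i).inner_bundle (h j)

variable (o : ∀ x : M, Orientation ℝ (TangentSpace (𝓡∂ n) x) (Fin n))

/-- The value of the volume form on the coordinate frame of the chart around `x`. -/
def frameVol (x y : M) : ℝ :=
  chartRep x (fun x => volForm (o x)) (extChartAt (𝓡∂ n) x y) (stdBasis n)

theorem frameVol_eq {x y : M} (hy : y ∈ (extChartAt (𝓡∂ n) x).source) :
    frameVol o x y = volForm (o y) (chartFrame x hy) :=
  chartRep_apply_stdBasis hy (fun x => volForm (o x)) id

theorem det_frameGram {x y : M} (hy : y ∈ (extChartAt (𝓡∂ n) x).source) :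
    (frameGram (n := n) x y).det = frameVol o x y ^ 2 := by
  rw [frameGram_eq hy, frameVol_eq o hy, det_gram (o y)]

theorem frameVol_ne_zero {x y : M} (hy : y ∈ (extChartAt (𝓡∂ n) x).source) :
    frameVol o x y ≠ 0 := by
  rw [frameVol_eq o hy]
  exact volForm_basis_ne_zero _ _

variable [IsContMDiffRiemannianBundle (𝓡∂ n) ∞ (EuclideanSpace ℝ (Fin n))
  (fun x : M => TangentSpace (𝓡∂ n) x)]

-- The square of the frame's volume is the determinant of the Gram matrix, which is positive and
-- smooth; the orientation fixes the sign of the square root near x.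
variable {o} in
theorem contMDiffAt_frameVol (ho : IsManifoldOrientation o) (x : M) :
    ContMDiffAt (𝓡∂ n) 𝓘(ℝ, ℝ) ∞ (frameVol o x) x := by
  have hx := mem_extChartAt_source (I := 𝓡∂ n) x
  have hdet : ContMDiffAt (𝓡∂ n) 𝓘(ℝ, ℝ) ∞ (fun y => (frameGram x y).det) x :=
    contMDiffAt_matrix_det (contMDiffAt_frameGram x)
  have hne : (frameGram (n := n) x x).det ≠ 0 := by
    rw [det_frameGram o hx]
    exact pow_ne_zero 2 (frameVol_ne_zero o hx)
  have hsqrt : ContMDiffAt (𝓡∂ n) 𝓘(ℝ, ℝ) ∞ (fun y => Real.sqrt (frameGram x y).det) x :=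
    (Real.contDiffAt_sqrt hne).contMDiffAt.comp x hdet
  have hb : (fun i => EuclideanSpace.single i 1 : Fin n → EuclideanSpace ℝ (Fin n)) =
      stdBasis n := by
    ext1 i; simp
  rcases ho x with h | h <;> rw [hb] at h
  · refine hsqrt.congr_of_eventuallyEq ?_
    filter_upwards [h, extChartAt_source_mem_nhds (I := 𝓡∂ n) x] with y hy hys
    have hy' : 0 ≤ frameVol o x y := le_of_lt hy
    rw [det_frameGram o hys, Real.sqrt_sq hy']
  · refine hsqrt.neg.congr_of_eventuallyEq ?_
    filter_upwards [h, extChartAt_source_mem_nhds (I := 𝓡∂ n) x] with y hy hys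
    have hy' : frameVol o x y ≤ 0 := le_of_lt hy
    change _ = -Real.sqrt _
    rw [det_frameGram o hys, ← neg_sq, Real.sqrt_sq (neg_nonneg.2 hy'), neg_neg]

variable {o} in
theorem SmoothFormAt.hodgeStar (ho : IsManifoldOrientation o) {x : M} {k l : ℕ} (h : k + l = n)
    {η : DForm n M k} (hη : SmoothFormAt x η) :
    SmoothFormAt x (fun y => VHodge.hodgeStar (o y) h (η y)) := by
  refine smoothFormAt_of_contMDiffAt fun K => ?_
  have hx := mem_extChartAt_source (I := 𝓡∂ n) x
  have hne : (frameGram (n := n) x x).det ≠ 0 := by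
    rw [det_frameGram o hx]
    exact pow_ne_zero 2 (frameVol_ne_zero o hx)
  have hsm : ContMDiffAt (𝓡∂ n) 𝓘(ℝ, ℝ) ∞ (fun y => (k ! : ℝ)⁻¹ * ∑ J : Fin k → Fin n,
      chartRep x η (extChartAt (𝓡∂ n) x y) (stdBasis n ∘ J) *
        (frameVol o x y * (starMatrix (frameGram x y) h J K).det)) x := by
    refine contMDiffAt_const.mul (ContMDiffAt.sum fun J _ => (contMDiffAt_chartRep hη _).mul
      ((contMDiffAt_frameVol ho x).mul (contMDiffAt_matrix_det fun a c => ?_)))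
    simp only [starMatrix, Matrix.of_apply]
    generalize Fin.cast h.symm c = c'
    refine Fin.addCases (fun i => ?_) (fun j => ?_) c'
    · simp only [Fin.append_left]
      exact contMDiffAt_matrix_inv (contMDiffAt_frameGram x) hne _ _
    · simp only [Fin.append_right]
      exact contMDiffAt_const
  refine hsm.congr_of_eventuallyEq ?_
  filter_upwards [extChartAt_source_mem_nhds (I := 𝓡∂ n) x] with y hy
  rw [chartRep_apply_stdBasis hy, hodgeStar_apply_basis_eq_det, frameVol_eq o hy, frameGram_eq hy]
  simp only [chartRep_apply_stdBasis hy]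

theorem SmoothFormAt.tMap {v : ∀ x : M, TangentSpace (𝓡∂ n) x}
    (hv : ContMDiff (𝓡∂ n) (𝓡∂ n).tangent ∞ (fun x => (⟨x, v x⟩ : TangentBundle (𝓡∂ n) M)))
    {x : M} {k : ℕ} {η : DForm n M k} (hη : SmoothFormAt x η) :
    SmoothFormAt x (fun y => VHodge.tMap (v y) (η y)) := by
  cases k with
  | zero => exact hη
  | succ k =>
    refine smoothFormAt_of_contMDiffAt fun J => ?_
    have hsm : ContMDiffAt (𝓡∂ n) 𝓘(ℝ, ℝ) ∞ (fun y =>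
        chartRep x η (extChartAt (𝓡∂ n) x y) (stdBasis n ∘ J) + ∑ i : Fin (k + 1),
          (((-1 : ℤ) ^ (i : ℕ) : ℤ) : ℝ) * ((∑ m, frameCoeff x v m y * frameGram x y m (J i)) *
            ∑ m, frameCoeff x v m y * chartRep x η (extChartAt (𝓡∂ n) x y)
              (stdBasis n ∘ (Fin.cons m (i.removeNth J) : Fin (k + 1) → Fin n)))) x := by
      refine (contMDiffAt_chartRep hη _).add (ContMDiffAt.sum fun i _ => contMDiffAt_const.mul
        (ContMDiffAt.mul (ContMDiffAt.sum fun m _ => ?_) (ContMDiffAt.sum fun m _ => ?_)))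
      · exact (contMDiffAt_frameCoeff hv x m).mul (contMDiffAt_frameGram x m _)
      · exact (contMDiffAt_frameCoeff hv x m).mul (contMDiffAt_chartRep hη _)
    refine hsm.congr_of_eventuallyEq ?_
    filter_upwards [extChartAt_source_mem_nhds (I := 𝓡∂ n) x] with y hy
    rw [chartRep_apply_stdBasis hy, tMap_succ_apply_basis]
    simp only [chartRep_apply_stdBasis hy, frameGram_eq hy, frameCoeff_eq hy, zsmul_eq_mul]

variable {o} in
theorem SmoothFormAt.hodgeStarV (ho : IsManifoldOrientation o) {v : ∀ x : M, TangentSpace (𝓡∂ n) x}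
    (hv : ContMDiff (𝓡∂ n) (𝓡∂ n).tangent ∞ (fun x => (⟨x, v x⟩ : TangentBundle (𝓡∂ n) M)))
    {x : M} {k l : ℕ} (h : k + l = n) {η : DForm n M k} (hη : SmoothFormAt x η) :
    SmoothFormAt x (fun y => VHodge.hodgeStarV (o y) (v y) h (η y)) :=
  (hη.tMap hv).hodgeStar ho h

end SmoothStar

/-! ### Smoothness of the inverse star operator and of the codifferential -/

section SmoothInverse

/-- If `S z (g z) = f z` with `S` and `f` smooth and `S` bijective, then `g` is smooth. -/
theorem contDiffWithinAt_of_clm_apply_eq {X F G : Type*} [NormedAddCommGroup X]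
    [NormedSpace ℝ X] [NormedAddCommGroup F] [NormedSpace ℝ F] [FiniteDimensional ℝ F]
    [NormedAddCommGroup G] [NormedSpace ℝ G] [FiniteDimensional ℝ G] {r : ℕ∞ω}
    {S : X → F →L[ℝ] G} {f : X → G} {g : X → F} {s : Set X} {z : X} (hz : z ∈ s)
    (hS : ∀ β, ContDiffWithinAt ℝ r (fun y => S y β) s z) (hf : ContDiffWithinAt ℝ r f s z)
    (hbij : ∀ᶠ y in 𝓝[s] z, Function.Bijective (S y)) (hSg : ∀ᶠ y in 𝓝[s] z, S y (g y) = f y) :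
    ContDiffWithinAt ℝ r g s z := by
  -- Smoothness on each vector of a basis gives smoothness as an operator-valued map, to which
  -- smoothness of inversion applies.
  have hS' : ContDiffWithinAt ℝ r S s z := by
    let L : (F →L[ℝ] G) →ₗ[ℝ] (Fin (finrank ℝ F) → G) :=
      { toFun := fun A i => A (finBasis ℝ F i)
        map_add' := fun _ _ => rfl
        map_smul' := fun _ _ => rfl }
    have hL : Function.Injective L := by
      intro A B hAB
      have h : (A : F →ₗ[ℝ] G) = B := (finBasis ℝ F).ext fun i => congrFun hAB i
      exact ContinuousLinearMap.coe_injective h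
    exact contDiffWithinAt_of_injective_comp hL (contDiffWithinAt_pi.2 fun i => hS _)
  have hequiv : ∀ y, Function.Bijective (S y) → ∃ e : F ≃L[ℝ] G, (e : F →L[ℝ] G) = S y :=
    fun y hy => ⟨(LinearEquiv.ofBijective (S y : F →ₗ[ℝ] G) hy).toContinuousLinearEquiv, by
      ext; rfl⟩
  obtain ⟨e, he⟩ := hequiv z (hbij.self_of_nhdsWithin hz)
  have hinv : ContDiffWithinAt ℝ r (fun y => (S y).inverse) s z := by
    have h : ContDiffAt ℝ r ContinuousLinearMap.inverse (S z) := he ▸ contDiffAt_map_inverse e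
    exact h.comp_contDiffWithinAt z hS'
  refine (hinv.clm_apply hf).congr_of_eventuallyEq_of_mem ?_ hz
  filter_upwards [hbij, hSg] with y hy hy'
  obtain ⟨e, he⟩ := hequiv y hy
  rw [← hy', ← he, ContinuousLinearMap.inverse_equiv]
  exact (e.symm_apply_apply _).symm

variable {n : ℕ} [NeZero n] {M : Type*} [TopologicalSpace M]
  [ChartedSpace (EuclideanHalfSpace n) M]

/-- The form with constant coefficients `β` in the chart around `x`. -/
def chartForm {k : ℕ} (x : M) (β : EuclideanSpace ℝ (Fin n) [⋀^Fin k]→L[ℝ] ℝ) : DForm n M k :=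
  fun y => β.compContinuousLinearMap
    (mfderiv (𝓡∂ n) 𝓘(ℝ, EuclideanSpace ℝ (Fin n)) (extChartAt (𝓡∂ n) x) y)

theorem chartRep_congr {k : ℕ} {x y : M} (hy : y ∈ (extChartAt (𝓡∂ n) x).source)
    {η θ : DForm n M k} (h : η y = θ y) :
    chartRep x η (extChartAt (𝓡∂ n) x y) = chartRep x θ (extChartAt (𝓡∂ n) x y) := by
  unfold chartRep
  rw [(extChartAt (𝓡∂ n) x).left_inv hy, h]

section Linear

variable [RiemannianBundle (fun x : M => TangentSpace (𝓡∂ n) x)]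
  (o : ∀ x : M, Orientation ℝ (TangentSpace (𝓡∂ n) x) (Fin n))
  (v : ∀ x : M, TangentSpace (𝓡∂ n) x)

theorem chartRep_hodgeStarV_chartForm_add (x : M) {k l : ℕ} (h : k + l = n)
    (z : EuclideanSpace ℝ (Fin n)) (β β' : EuclideanSpace ℝ (Fin n) [⋀^Fin k]→L[ℝ] ℝ) :
    chartRep x (fun y => hodgeStarV (o y) (v y) h (chartForm x (β + β') y)) z =
      chartRep x (fun y => hodgeStarV (o y) (v y) h (chartForm x β y)) z +
        chartRep x (fun y => hodgeStarV (o y) (v y) h (chartForm x β' y)) z := by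
  have h1 : ∀ y, hodgeStarV (o y) (v y) h (chartForm x (β + β') y) =
      hodgeStarV (o y) (v y) h (chartForm x β y) + hodgeStarV (o y) (v y) h (chartForm x β' y) :=
    fun y => (hodgeStarVₗ (o y) (v y) h).map_add (chartForm x β y) (chartForm x β' y)
  simp only [h1]
  rfl

theorem chartRep_hodgeStarV_chartForm_smul (x : M) {k l : ℕ} (h : k + l = n)
    (z : EuclideanSpace ℝ (Fin n)) (c : ℝ) (β : EuclideanSpace ℝ (Fin n) [⋀^Fin k]→L[ℝ] ℝ) :
    chartRep x (fun y => hodgeStarV (o y) (v y) h (chartForm x (c • β) y)) z =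
      c • chartRep x (fun y => hodgeStarV (o y) (v y) h (chartForm x β y)) z := by
  have h1 : ∀ y, hodgeStarV (o y) (v y) h (chartForm x (c • β) y) =
      c • hodgeStarV (o y) (v y) h (chartForm x β y) :=
    fun y => (hodgeStarVₗ (o y) (v y) h).map_smul c (chartForm x β y)
  simp only [h1]
  rfl

end Linear

variable [IsManifold (𝓡∂ n) ∞ M]

theorem chartRep_chartForm {k : ℕ} (x : M) (β : EuclideanSpace ℝ (Fin n) [⋀^Fin k]→L[ℝ] ℝ)
    {z : EuclideanSpace ℝ (Fin n)} (hz : z ∈ (extChartAt (𝓡∂ n) x).target) :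
    chartRep x (chartForm x β) z = β := by
  have hinv := mfderiv_extChartAt_comp_mfderivWithin_extChartAt_symm (I := 𝓡∂ n) hz
  refine ContinuousAlternatingMap.ext fun w => congrArg β (funext fun i => ?_)
  exact congrArg (fun L : EuclideanSpace ℝ (Fin n) →L[ℝ] EuclideanSpace ℝ (Fin n) => L (w i)) hinv

theorem smoothFormAt_chartForm {k : ℕ} (x : M)
    (β : EuclideanSpace ℝ (Fin n) [⋀^Fin k]→L[ℝ] ℝ) : SmoothFormAt x (chartForm x β) := by
  refine (contDiffWithinAt_const (c := β)).congr_of_eventuallyEq_of_mem ?_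
    (extChartAt_mem_range x x)
  filter_upwards [extChartAt_target_mem_nhdsWithin x] with z hz
  exact chartRep_chartForm x β hz

theorem chartForm_chartRep {k : ℕ} {x y : M} (hy : y ∈ (extChartAt (𝓡∂ n) x).source)
    (η : DForm n M k) : chartForm x (chartRep x η (extChartAt (𝓡∂ n) x y)) y = η y :=
  ContinuousAlternatingMap.ext fun w => chartRep_comp_mfderiv hy η w

theorem eq_of_chartRep_eq {k : ℕ} {x y : M} (hy : y ∈ (extChartAt (𝓡∂ n) x).source)
    {η θ : DForm n M k}
    (h : chartRep x η (extChartAt (𝓡∂ n) x y) = chartRep x θ (extChartAt (𝓡∂ n) x y)) :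
    η y = θ y := by
  rw [← chartForm_chartRep hy η, h, chartForm_chartRep hy θ]

variable [RiemannianBundle (fun x : M => TangentSpace (𝓡∂ n) x)]
  [IsContMDiffRiemannianBundle (𝓡∂ n) ∞ (EuclideanSpace ℝ (Fin n))
    (fun x : M => TangentSpace (𝓡∂ n) x)]
  {o : ∀ x : M, Orientation ℝ (TangentSpace (𝓡∂ n) x) (Fin n)} {v : ∀ x : M, TangentSpace (𝓡∂ n) x}

theorem SmoothFormAt.hodgeStarVInv (ho : IsManifoldOrientation o)
    (hv : ContMDiff (𝓡∂ n) (𝓡∂ n).tangent ∞ (fun x => (⟨x, v x⟩ : TangentBundle (𝓡∂ n) M)))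
    {x : M} {k l : ℕ} (h : k + l = n) {η : DForm n M l} (hη : SmoothFormAt x η) :
    SmoothFormAt x (fun y => VHodge.hodgeStarVInv (o y) (v y) h (η y)) := by
  -- The operator `⋆_v` in coordinates, read off from its action on forms with constant
  -- coefficients; `⋆_v⁻¹ η` is then the unique solution of a smooth linear system.
  let S (z : EuclideanSpace ℝ (Fin n)) : (EuclideanSpace ℝ (Fin n) [⋀^Fin k]→L[ℝ] ℝ) →ₗ[ℝ]
      (EuclideanSpace ℝ (Fin n) [⋀^Fin l]→L[ℝ] ℝ) :=
    { toFun := fun β => chartRep x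
        (fun y => VHodge.hodgeStarV (o y) (v y) h (chartForm x β y)) z
      map_add' := chartRep_hodgeStarV_chartForm_add o v x h z
      map_smul' := chartRep_hodgeStarV_chartForm_smul o v x h z }
  have hSη : ∀ (θ : DForm n M k) (y : M), y ∈ (extChartAt (𝓡∂ n) x).source →
      S (extChartAt (𝓡∂ n) x y) (chartRep x θ (extChartAt (𝓡∂ n) x y)) =
        chartRep x (fun y => VHodge.hodgeStarV (o y) (v y) h (θ y)) (extChartAt (𝓡∂ n) x y) :=
    fun θ y hy => chartRep_congr (η := fun y' => VHodge.hodgeStarV (o y') (v y') h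
        (chartForm x (chartRep x θ (extChartAt (𝓡∂ n) x y)) y')) hy
      (congrArg (VHodge.hodgeStarV (o y) (v y) h) (chartForm_chartRep hy θ))
  have hSinv : ∀ (θ : DForm n M l) (y : M), y ∈ (extChartAt (𝓡∂ n) x).source →
      S (extChartAt (𝓡∂ n) x y) (chartRep x (fun y => VHodge.hodgeStarVInv (o y) (v y) h (θ y))
        (extChartAt (𝓡∂ n) x y)) = chartRep x θ (extChartAt (𝓡∂ n) x y) :=
    fun θ y hy => (hSη _ y hy).trans (chartRep_congr hy (hodgeStarV_hodgeStarVInv _ _ _ _))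
  have htarget := extChartAt_target_mem_nhdsWithin (I := 𝓡∂ n) x
  refine contDiffWithinAt_of_clm_apply_eq (S := fun z => LinearMap.toContinuousLinearMap (S z))
    (f := chartRep x η) (extChartAt_mem_range x x) (fun β => ?_) hη ?_ ?_
  · exact (smoothFormAt_chartForm x β).hodgeStarV ho hv h
  · filter_upwards [htarget] with z hz
    obtain ⟨y, hy, rfl⟩ : ∃ y ∈ (extChartAt (𝓡∂ n) x).source, extChartAt (𝓡∂ n) x y = z :=
      ⟨_, (extChartAt (𝓡∂ n) x).map_target hz, (extChartAt (𝓡∂ n) x).right_inv hz⟩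
    refine ⟨fun β β' hβ => ?_, fun γ => ⟨_, (hSinv (chartForm x γ) y hy).trans
      (chartRep_chartForm x γ hz)⟩⟩
    have h1 := (hodgeStarV_bijective (o y) (v y) h).1 (eq_of_chartRep_eq
      (η := fun y => VHodge.hodgeStarV (o y) (v y) h (chartForm x β y))
      (θ := fun y => VHodge.hodgeStarV (o y) (v y) h (chartForm x β' y)) hy hβ)
    rw [← chartRep_chartForm x β hz, ← chartRep_chartForm x β' hz]
    exact chartRep_congr hy h1
  · filter_upwards [htarget] with z hz
    have h1 := hSinv η _ ((extChartAt (𝓡∂ n) x).map_target hz)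
    rw [(extChartAt (𝓡∂ n) x).right_inv hz] at h1
    exact h1

theorem SmoothFormAt.codiffV (ho : IsManifoldOrientation o)
    (hv : ContMDiff (𝓡∂ n) (𝓡∂ n).tangent ∞ (fun x => (⟨x, v x⟩ : TangentBundle (𝓡∂ n) M)))
    {x : M} {k : ℕ} {η : DForm n M (k + 1)} (hη : SmoothFormAt x η) :
    SmoothFormAt x (VHodge.codiffV o v η) := by
  by_cases h : k + 1 ≤ n
  · have h1 := ((((hη.hodgeStarV ho hv (l := n - (k + 1)) (by omega)).dExt).hodgeStarVInv ho hv
      (k := k) (by omega)).const_smul ((-1) ^ (k + 1)))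
    have h2 : VHodge.codiffV o v η = fun y => (-1 : ℝ) ^ (k + 1) •
        VHodge.hodgeStarVInv (l := n - (k + 1) + 1) (o y) (v y) (by omega)
          (VHodge.dExt (fun y => VHodge.hodgeStarV (l := n - (k + 1)) (o y) (v y) (by omega)
            (η y)) y) := by
      ext1 y
      rw [VHodge.codiffV, dif_pos h]
    rw [h2]
    exact h1
  · have h2 : VHodge.codiffV o v η = chartForm x 0 := by
      ext1 y
      rw [VHodge.codiffV, dif_neg h]
      rfl
    rw [h2]
    exact smoothFormAt_chartForm x 0

end SmoothInverse

/-! ### The principal symbols of `δ_v` and `Δ_v` -/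

section PointwiseLeibniz

/-- A twofold application of a Leibniz rule `D (f β) = L β + f D β`. -/
theorem leibniz_sq {A B : Type*} [AddCommGroup A] [Module ℝ A] [AddCommGroup B] [Module ℝ B]
    {L : A → B} {c : ℝ} {β : A} {D D₁ D₂ : B} (hL : L (c • β) = c • L β) (h₁ : D₁ = L β + c • D)
    (h₂ : D₂ = L (c • β) + c • D₁) :
    D₂ = c • ((2 : ℝ) • (D₁ + (-1 : ℝ) • c • D) + c • D) := by
  rw [h₂, hL, h₁]
  module

variable {V : Type*} [NormedAddCommGroup V] [InnerProductSpace ℝ V]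

theorem wedgeCovector_smul {k : ℕ} (ξ : V →L[ℝ] ℝ) (c : ℝ) (β : V [⋀^Fin k]→L[ℝ] ℝ) :
    wedgeCovector ξ (c • β) = c • wedgeCovector ξ β :=
  covectorWedge_smul_right c ξ β

/-- The symbol term ξ ∧ β is written as D₁ - c D, that is d(fη) - f dη. In this form the bracket is
visibly smooth, and a further Leibniz rule can be applied to it. -/
theorem wedgeCovector_leibniz {k : ℕ} {ξ : V →L[ℝ] ℝ} {c : ℝ} {β : V [⋀^Fin k]→L[ℝ] ℝ}
    {D D₁ D₂ : V [⋀^Fin (k + 1)]→L[ℝ] ℝ} (h₁ : D₁ = wedgeCovector ξ β + c • D)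
    (h₂ : D₂ = wedgeCovector ξ (c • β) + c • D₁) :
    D₂ = c • ((2 : ℝ) • (D₁ + (-1 : ℝ) • c • D) + c • D) := by
  rw [h₂, wedgeCovector_smul, h₁]
  module

theorem wedgeCovector_leibniz_sq {k : ℕ} {ξ : V →L[ℝ] ℝ} {X : V} {c : ℝ} (hc : c = 0)
    {β : V [⋀^Fin (k + 1)]→L[ℝ] ℝ} {D D₁ : V [⋀^Fin k]→L[ℝ] ℝ} {Z R : V [⋀^Fin (k + 1)]→L[ℝ] ℝ}
    (h₁ : D₁ = -contraction X β + c • D)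
    (h : R = wedgeCovector ξ ((2 : ℝ) • (D₁ + (-1 : ℝ) • c • D) + c • D) + c • Z) :
    R = (-2 : ℝ) • wedgeCovector ξ (contraction X β) := by
  rw [h, h₁, hc, ← wedgeCovector_smul, zero_smul, zero_smul, add_zero, add_zero]
  congr 1
  module

theorem contraction_leibniz_sq {k : ℕ} {ξ : V →L[ℝ] ℝ} {X : V} {c : ℝ} (hc : c = 0)
    {β : V [⋀^Fin k]→L[ℝ] ℝ} {D D₁ : V [⋀^Fin (k + 1)]→L[ℝ] ℝ} {Z R : V [⋀^Fin k]→L[ℝ] ℝ}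
    (h₁ : D₁ = wedgeCovector ξ β + c • D)
    (h : R = -contraction X ((2 : ℝ) • (D₁ + (-1 : ℝ) • c • D) + c • D) + c • Z) :
    R = (-2 : ℝ) • contraction X (wedgeCovector ξ β) := by
  rw [h, h₁, hc, ← map_smul, zero_smul, zero_smul, add_zero, add_zero, ← map_neg]
  congr 1
  module

variable [FiniteDimensional ℝ V]

theorem laplacianSymbol_zero_eq (v : V) (ξ : V →L[ℝ] ℝ) (β : V [⋀^Fin 0]→L[ℝ] ℝ) :
    (-2 : ℝ) • contraction (covectorVector v ξ) (wedgeCovector ξ β) =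
      (2 ! : ℝ) • laplacianSymbol v ξ β := by
  rw [contraction_apply, wedgeCovector_eq, curryLeft_covectorWedge_zero]
  simp only [laplacianSymbol, LinearMap.smul_apply, LinearMap.id_apply, Nat.factorial_two,
    Nat.cast_ofNat]
  module

/-- Cartan's identity ξ ∧ ι_X β + ι_X(ξ ∧ β) = ξ(X) β. -/
theorem laplacianSymbol_succ_eq (v : V) (ξ : V →L[ℝ] ℝ) {k : ℕ}
    (β : V [⋀^Fin (k + 1)]→L[ℝ] ℝ) :
    (-2 : ℝ) • wedgeCovector ξ (contraction (covectorVector v ξ) β) +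
      (-2 : ℝ) • contraction (covectorVector v ξ) (wedgeCovector ξ β) =
      (2 ! : ℝ) • laplacianSymbol v ξ β := by
  rw [contraction_apply, contraction_apply, wedgeCovector_eq, wedgeCovector_eq,
    curryLeft_covectorWedge_succ]
  simp only [laplacianSymbol, LinearMap.smul_apply, LinearMap.id_apply, Nat.factorial_two,
    Nat.cast_ofNat]
  module

theorem hodgeStarVInv_leibniz {n : ℕ} [Fact (finrank ℝ V = n)] (o : Orientation ℝ V (Fin n))
    (v : V) (ξ : V →L[ℝ] ℝ) {k l : ℕ} (h : k + 1 + l = n) (h' : k + (l + 1) = n)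
    (β : V [⋀^Fin (k + 1)]→L[ℝ] ℝ) (c : ℝ) (D : V [⋀^Fin (l + 1)]→L[ℝ] ℝ) :
    (-1 : ℝ) ^ (k + 1) • hodgeStarVInv o v h' (wedgeCovector ξ (hodgeStarV o v h β) + c • D) =
      -contraction (covectorVector v ξ) β + c • (-1 : ℝ) ^ (k + 1) • hodgeStarVInv o v h' D := by
  have h3 := hodgeStarVInv_wedgeCovector o v (sharp ξ) h h' β
  rw [innerSL_sharp] at h3
  rw [hodgeStarVInv_add, hodgeStarVInv_smul, smul_add, h3, smul_comm c]
  rfl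

end PointwiseLeibniz

section PrincipalSymbols

variable {n : ℕ} [NeZero n] {M : Type*} [TopologicalSpace M]
  [ChartedSpace (EuclideanHalfSpace n) M] [IsManifold (𝓡∂ n) ∞ M]
  [RiemannianBundle (fun x : M => TangentSpace (𝓡∂ n) x)]
  {o : ∀ x : M, Orientation ℝ (TangentSpace (𝓡∂ n) x) (Fin n)} {v : ∀ x : M, TangentSpace (𝓡∂ n) x}
  {f : M → ℝ}

theorem dExt_sq_smul {k : ℕ} {η : DForm n M k} (hη : ∀ y, SmoothFormAt y η)
    (hf : ContMDiff (𝓡∂ n) 𝓘(ℝ, ℝ) ∞ f) :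
    dExt (fun y => f y ^ 2 • η y) = fun y => f y • ((2 : ℝ) •
      (dExt (fun y => f y • η y) y + (-1 : ℝ) • f y • dExt η y) + f y • dExt η y) := by
  simp only [sq, mul_smul]
  ext1 y
  have h1 := dExt_smul (hη y) hf
  have h2 := dExt_smul ((hη y).smul hf) hf
  exact wedgeCovector_leibniz h1 h2

variable [IsContMDiffRiemannianBundle (𝓡∂ n) ∞ (EuclideanSpace ℝ (Fin n))
    (fun x : M => TangentSpace (𝓡∂ n) x)]

/-- The Leibniz rule for `δ_v`. -/
theorem codiffV_smul (ho : IsManifoldOrientation o)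
    (hv : ContMDiff (𝓡∂ n) (𝓡∂ n).tangent ∞ (fun x => (⟨x, v x⟩ : TangentBundle (𝓡∂ n) M)))
    {x : M} {k : ℕ} {η : DForm n M (k + 1)} (hη : SmoothFormAt x η)
    (hf : ContMDiff (𝓡∂ n) 𝓘(ℝ, ℝ) ∞ f) :
    codiffV o v (fun y => f y • η y) x =
      -contraction (covectorVector (v x) (mfderiv (𝓡∂ n) 𝓘(ℝ, ℝ) f x)) (η x) +
        f x • codiffV o v η x := by
  by_cases h : k + 1 ≤ n
  · have h1 : (fun y => hodgeStarV (l := n - (k + 1)) (o y) (v y) (by omega) (f y • η y)) =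
        fun y => f y • hodgeStarV (l := n - (k + 1)) (o y) (v y) (by omega) (η y) :=
      funext fun y => (hodgeStarVₗ (o y) (v y) (by omega)).map_smul (f y) (η y)
    have h2 := dExt_smul (hη.hodgeStarV ho hv (l := n - (k + 1)) (by omega)) hf
    rw [codiffV, codiffV, dif_pos h, dif_pos h, h1]
    exact (congrArg (fun D => (-1 : ℝ) ^ (k + 1) • hodgeStarVInv (o x) (v x) (by omega) D) h2).trans
      (hodgeStarVInv_leibniz (o x) (v x) (mfderiv (𝓡∂ n) 𝓘(ℝ, ℝ) f x) _ _ (η x) (f x) _)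
  -- Above the top degree `δ_v` is 0 by definition, and the contraction term vanishes because there
  -- are no nonzero forms.
  · have h1 : η x = 0 := form_eq_zero_of_finrank_lt
      (by rw [(tangentSpaceFinrank x).out]; omega) _
    rw [codiffV, codiffV, dif_neg h, dif_neg h, h1, map_zero, neg_zero, smul_zero, zero_add]

theorem codiffV_sq_smul (ho : IsManifoldOrientation o)
    (hv : ContMDiff (𝓡∂ n) (𝓡∂ n).tangent ∞ (fun x => (⟨x, v x⟩ : TangentBundle (𝓡∂ n) M)))
    {k : ℕ} {η : DForm n M (k + 1)} (hη : ∀ y, SmoothFormAt y η)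
    (hf : ContMDiff (𝓡∂ n) 𝓘(ℝ, ℝ) ∞ f) :
    codiffV o v (fun y => f y ^ 2 • η y) = fun y => f y • ((2 : ℝ) •
      (codiffV o v (fun y => f y • η y) y + (-1 : ℝ) • f y • codiffV o v η y) +
        f y • codiffV o v η y) := by
  simp only [sq, mul_smul]
  exact funext fun y => leibniz_sq ((-contraction (covectorVector (v y) _)).map_smul (f y) (η y))
    (codiffV_smul ho hv (hη y) hf) (codiffV_smul ho hv ((hη y).smul hf) hf)

/-- δ_v(f²η) is f times a smooth form whose value at x is -2 ι_X η, since f x = 0. Applying d, only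
df ∧ that value survives at x. -/
theorem dExt_codiffV_sq_smul (ho : IsManifoldOrientation o)
    (hv : ContMDiff (𝓡∂ n) (𝓡∂ n).tangent ∞ (fun x => (⟨x, v x⟩ : TangentBundle (𝓡∂ n) M)))
    {x : M} {k : ℕ} {η : DForm n M (k + 1)} (hη : ∀ y, SmoothFormAt y η)
    (hf : ContMDiff (𝓡∂ n) 𝓘(ℝ, ℝ) ∞ f) (hfx : f x = 0) :
    dExt (codiffV o v (fun y => f y ^ 2 • η y)) x =
      (-2 : ℝ) • wedgeCovector (mfderiv (𝓡∂ n) 𝓘(ℝ, ℝ) f x)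
        (contraction (covectorVector (v x) (mfderiv (𝓡∂ n) 𝓘(ℝ, ℝ) f x)) (η x)) := by
  have hB := (hη x).codiffV ho hv
  have hA := ((hη x).smul hf).codiffV ho hv
  rw [codiffV_sq_smul ho hv hη hf]
  exact wedgeCovector_leibniz_sq hfx (codiffV_smul ho hv (hη x) hf)
    (dExt_smul (((hA.add ((hB.smul hf).const_smul (-1))).const_smul 2).add (hB.smul hf)) hf)

theorem codiffV_dExt_sq_smul (ho : IsManifoldOrientation o)
    (hv : ContMDiff (𝓡∂ n) (𝓡∂ n).tangent ∞ (fun x => (⟨x, v x⟩ : TangentBundle (𝓡∂ n) M)))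
    {x : M} {k : ℕ} {η : DForm n M k} (hη : ∀ y, SmoothFormAt y η)
    (hf : ContMDiff (𝓡∂ n) 𝓘(ℝ, ℝ) ∞ f) (hfx : f x = 0) :
    codiffV o v (dExt (fun y => f y ^ 2 • η y)) x =
      (-2 : ℝ) • contraction (covectorVector (v x) (mfderiv (𝓡∂ n) 𝓘(ℝ, ℝ) f x))
        (wedgeCovector (mfderiv (𝓡∂ n) 𝓘(ℝ, ℝ) f x) (η x)) := by
  have hB := (hη x).dExt
  have hA := ((hη x).smul hf).dExt
  rw [dExt_sq_smul hη hf]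
  exact contraction_leibniz_sq hfx (dExt_smul (hη x) hf)
    (codiffV_smul ho hv (((hA.add ((hB.smul hf).const_smul (-1))).const_smul 2).add
      (hB.smul hf)) hf)

end PrincipalSymbols

/-! ### Inward conormals at boundary points. -/

section Conormal

variable {n : ℕ} [NeZero n] {M : Type*} [TopologicalSpace M]
  [ChartedSpace (EuclideanHalfSpace n) M]

theorem boundaryTangent_eq_ker {x : M} {ν : TangentSpace (𝓡∂ n) x →L[ℝ] ℝ}
    (hν : ∃ c : ℝ, 0 < c ∧ ν = c • boundaryConormal x) :
    boundaryTangent x = LinearMap.ker ν.toLinearMap := by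
  obtain ⟨c, hc, rfl⟩ := hν
  exact (LinearMap.ker_smul (boundaryConormal x).toLinearMap c hc.ne').symm

/-- At its own base point the preferred chart has identity differential, so the boundary conormal
takes the value 1 on the first coordinate vector. -/
theorem inwardConormal_ne_zero [IsManifold (𝓡∂ n) ∞ M] {x : M}
    {ν : TangentSpace (𝓡∂ n) x →L[ℝ] ℝ}
    (hν : ∃ c : ℝ, 0 < c ∧ ν = c • boundaryConormal x) : ν ≠ 0 := by
  obtain ⟨c, hc, rfl⟩ := hν
  refine smul_ne_zero hc.ne' fun h => ?_
  rw [boundaryConormal, mfderiv_extChartAt_self] at h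
  have h1 := congrArg (fun L : EuclideanSpace ℝ (Fin n) →L[ℝ] ℝ => L (EuclideanSpace.single 0 1)) h
  change (EuclideanSpace.single (0 : Fin n) (1 : ℝ)) 0 = 0 at h1
  simp at h1

end Conormal

/-! ### The principal symbols in the boundary value problem. -/

section PrincipalSymbols

variable {n : ℕ} [NeZero n] {M : Type*} [TopologicalSpace M]
  [ChartedSpace (EuclideanHalfSpace n) M]
  [RiemannianBundle (fun x : M => TangentSpace (𝓡∂ n) x)]

theorem isPrincipalSymbolAt_pullbackBoundary (x : (𝓡∂ n).boundary M) (k : ℕ) :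
    IsPrincipalSymbolAt 0 (x : M) (fun η : DForm n M k => pullbackBoundary η x)
      (fun _ => restrictFormₗ (V := TangentSpace (𝓡∂ n) (x : M))
        (boundaryTangent (n := n) (x : M))) := by
  intro f η _ _ _
  simp only [pow_zero, one_smul, Nat.factorial_zero, Nat.cast_one]
  rfl

variable [IsManifold (𝓡∂ n) ∞ M]
  [IsContMDiffRiemannianBundle (𝓡∂ n) ∞ (EuclideanSpace ℝ (Fin n))
    (fun x : M => TangentSpace (𝓡∂ n) x)]
  {o : ∀ x : M, Orientation ℝ (TangentSpace (𝓡∂ n) x) (Fin n)} {v : ∀ x : M, TangentSpace (𝓡∂ n) x}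

theorem isPrincipalSymbolAt_laplacianV (ho : IsManifoldOrientation o)
    (hv : ContMDiff (𝓡∂ n) (𝓡∂ n).tangent ∞ (fun x => (⟨x, v x⟩ : TangentBundle (𝓡∂ n) M)))
    (x : M) (k : ℕ) :
    IsPrincipalSymbolAt 2 x (fun η => laplacianV o v (k := k) η x) 
      (laplacianSymbol (V := TangentSpace (𝓡∂ n) x) (v x)) := by
  intro f η hf hη hfx
  have h := codiffV_dExt_sq_smul ho hv hη.smoothFormAt hf hfx
  cases k with
  | zero => exact h.trans (laplacianSymbol_zero_eq (v x) (mfderiv (𝓡∂ n) 𝓘(ℝ, ℝ) f x) (η x))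
  | succ k =>
    exact (congrArg₂ (· + ·) (dExt_codiffV_sq_smul ho hv hη.smoothFormAt hf hfx) h).trans
      (laplacianSymbol_succ_eq (v x) (mfderiv (𝓡∂ n) 𝓘(ℝ, ℝ) f x) (η x))

theorem isPrincipalSymbolAt_pullbackBoundary_codiffV (ho : IsManifoldOrientation o)
    (hv : ContMDiff (𝓡∂ n) (𝓡∂ n).tangent ∞ (fun x => (⟨x, v x⟩ : TangentBundle (𝓡∂ n) M)))
    (x : (𝓡∂ n).boundary M) (k : ℕ) :
    IsPrincipalSymbolAt 1 (x : M) (fun η : DForm n M (k + 1) => pullbackBoundary (codiffV o v η) x)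
      (codiffSymbol (V := TangentSpace (𝓡∂ n) (x : M)) (boundaryTangent (n := n) (x : M)) (v x)) := by
  intro f η hf hη hfx
  have h1 := codiffV_smul ho hv (hη.smoothFormAt (x : M)) hf
  rw [hfx, zero_smul, add_zero] at h1
  simp only [pow_one, Nat.factorial_one, Nat.cast_one, one_smul]
  exact congrArg (restrictFormₗ (V := TangentSpace (𝓡∂ n) (x : M)) (boundaryTangent (n := n) (x : M))) h1

end PrincipalSymbols

end VHodge

end

/-! ### Ellipticity of the boundary value problem. -/

theorem mainTheorem4 (n : ℕ) [NeZero n]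
    (M : Type*) [TopologicalSpace M] [T2Space M] [CompactSpace M]
    [ChartedSpace (EuclideanHalfSpace n) M] [IsManifold (𝓡∂ n) ∞ M]
    [RiemannianBundle (fun x : M => TangentSpace (𝓡∂ n) x)]
    [IsContMDiffRiemannianBundle (𝓡∂ n) ∞ (EuclideanSpace ℝ (Fin n))
      (fun x : M => TangentSpace (𝓡∂ n) x)]
    (o : ∀ x : M, Orientation ℝ (TangentSpace (𝓡∂ n) x) (Fin n))
    (ho : VHodge.IsManifoldOrientation o)
    (v : ∀ x : M, TangentSpace (𝓡∂ n) x)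
    (hv : ContMDiff (𝓡∂ n) (𝓡∂ n).tangent ∞
      (fun x => (⟨x, v x⟩ : TangentBundle (𝓡∂ n) M)))
    (k : ℕ) :
    VHodge.IsLopatinskiiShapiroElliptic 2 (VHodge.laplacianV o v (k := k))
      (VHodge.boundaryConditionsV o v k) := by
  refine ⟨fun x => ⟨_, VHodge.isPrincipalSymbolAt_laplacianV ho hv x k, fun ξ hξ =>
    VHodge.laplacianSymbol_bijective (v x) hξ⟩, fun x =>
    ⟨_, VHodge.isPrincipalSymbolAt_laplacianV ho hv (x : M) k, ?_⟩⟩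
  -- The list of boundary operators has one entry on functions and two in positive degree.
  cases k with
  | zero =>
    refine ⟨fun i => match i with
      | ⟨0, _⟩ => fun _ => VHodge.restrictFormₗ (V := TangentSpace (𝓡∂ n) (x : M))
          (VHodge.boundaryTangent (n := n) (x : M)), fun i => match i with
      | ⟨0, _⟩ => VHodge.isPrincipalSymbolAt_pullbackBoundary x 0, fun ξ ν hξ hν => ?_⟩
    have hker := VHodge.boundaryTangent_eq_ker hν
    have hne := VHodge.inwardConormal_ne_zero hν
    refine ⟨_, VHodge.isSymbolExpansion_laplacian (V := TangentSpace (𝓡∂ n) (x : M)) (v x) ξ ν,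
      fun i => match i with
      | ⟨0, _⟩ => fun _ => VHodge.restrictFormₗ (V := TangentSpace (𝓡∂ n) (x : M))
          (VHodge.boundaryTangent (n := n) (x : M)), fun i => match i with
      | ⟨0, _⟩ => VHodge.isSymbolExpansion_restrict (V := TangentSpace (𝓡∂ n) (x : M)) _ ξ ν,
      fun h => ?_⟩
    obtain ⟨u, ⟨h1, h2, h3, h4⟩, h5⟩ := VHodge.existsUnique_solution_zero
      (V := TangentSpace (𝓡∂ n) (x : M)) (v x) hker hξ hne (h ⟨0, Nat.one_pos⟩)
    refine ⟨u, ⟨h1, h2, h3, fun i => match i with | ⟨0, _⟩ => h4⟩, ?_⟩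
    rintro u' ⟨h1', h2', h3', h4'⟩
    exact h5 u' ⟨h1', h2', h3', h4' ⟨0, Nat.one_pos⟩⟩
  | succ k =>
    refine ⟨fun i => match i with
      | ⟨0, _⟩ => fun _ => VHodge.restrictFormₗ (V := TangentSpace (𝓡∂ n) (x : M))
          (VHodge.boundaryTangent (n := n) (x : M))
      | ⟨1, _⟩ => VHodge.codiffSymbol (V := TangentSpace (𝓡∂ n) (x : M))
          (VHodge.boundaryTangent (n := n) (x : M)) (v x), fun i => match i with
      | ⟨0, _⟩ => VHodge.isPrincipalSymbolAt_pullbackBoundary x (k + 1)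
      | ⟨1, _⟩ => VHodge.isPrincipalSymbolAt_pullbackBoundary_codiffV ho hv x k,
      fun ξ ν hξ hν => ?_⟩
    have hker := VHodge.boundaryTangent_eq_ker hν
    have hne := VHodge.inwardConormal_ne_zero hν
    refine ⟨_, VHodge.isSymbolExpansion_laplacian (V := TangentSpace (𝓡∂ n) (x : M)) (v x) ξ ν,
      fun i => match i with
      | ⟨0, _⟩ => fun _ => VHodge.restrictFormₗ (V := TangentSpace (𝓡∂ n) (x : M))
          (VHodge.boundaryTangent (n := n) (x : M))
      | ⟨1, _⟩ => VHodge.codiffCoeff (V := TangentSpace (𝓡∂ n) (x : M))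
          (VHodge.boundaryTangent (n := n) (x : M)) (v x) ξ ν, fun i => match i with
      | ⟨0, _⟩ => VHodge.isSymbolExpansion_restrict (V := TangentSpace (𝓡∂ n) (x : M)) _ ξ ν
      | ⟨1, _⟩ => VHodge.isSymbolExpansion_codiff (V := TangentSpace (𝓡∂ n) (x : M)) _ (v x) ξ ν,
      fun h => ?_⟩
    obtain ⟨u, ⟨h1, h2, h3, h4, h4'⟩, h5⟩ := VHodge.existsUnique_solution_succ
      (V := TangentSpace (𝓡∂ n) (x : M)) (v x) hker hξ hne (h ⟨0, Nat.two_pos⟩)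
      (h ⟨1, Nat.one_lt_two⟩)
    refine ⟨u, ⟨h1, h2, h3, fun i => match i with
      | ⟨0, _⟩ => h4
      | ⟨1, _⟩ => h4'⟩, ?_⟩
    rintro u' ⟨g1, g2, g3, g4⟩
    exact h5 u' ⟨g1, g2, g3, g4 ⟨0, Nat.two_pos⟩, g4 ⟨1, Nat.one_lt_two⟩⟩
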